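/- Let $R$ be a commutative ring, $F$ a commutative one-dimensional formal group law over $R$, and let $M$ be a free $\mathbb Z$-module of finite rank with a reduced root datum (finitely many roots $\alpha\in M$ with coroots $\alpha^\vee\in M^\vee$), with a fixed basis of simple roots. Let $W$ be the Weyl group, with its length function with respect to the simple reflections, $w_0$ its longest element and $N$ the length of $w_0$. *Formal group ring.* Let $R[\![x_M]\!]$ be the completion of the polynomial ring $R[x_\lambda,\ \lambda\in M]$ at the kernel of $x_\lambda\mapsto 0$, and let $R[\![M]\!]_F$ be its quotient by the closure of the ideal generated by $x_0$ and all $x_{\lambda+\mu}-F(x_\lambda,x_\mu)$. Let $\mathcal I_F$ be the kernel of the augmentation $R[\![M]\!]_F\to R$, $x_\lambda\mapsto 0$. The group $W$ acts on $R[\![M]\!]_F$ by $w(x_\lambda)=x_{w(\lambda)}$ (continuous $R$-algebra automorphisms), and $R[\![M]\!]_F^W$ is the subring of invariants. Assume that $R$ has no $2$-torsion (i.e. $2r=0$ implies $r=0$ in $R$). Then each $x_\alpha$ is regular in $R[\![M]\!]_F$ and $u-s_\alpha(u)$ is divisible by $x_\alpha$ for every $u$. *Operators.* For a root $\alpha$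 and $u\in R[\![M]\!]_F$ put $$\Delta_\alpha(u)=\frac{u-s_\alpha(u)}{x_\alpha},\qquad C_\alpha(u)=g(x_\alpha,x_{-\alpha})\,u-\Delta_\alpha(u),$$ where $g$ is the power series with $F(x,y)=x+y-xy\,g(x,y)$. For a sequence $I=(i_1,\dots,i_l)$ of indices of simple roots, $\Delta_I=\Delta_{\alpha_{i_1}}\circ\cdots\circ\Delta_{\alpha_{i_l}}$ and $C_I=C_{\alpha_{i_1}}\circ\cdots\circ C_{\alpha_{i_l}}$. A reduced decomposition of $w\in W$ is such a sequence $I$ with $s_{i_1}\cdots s_{i_l}=w$ and $l=\ell(w)$. *Torsion index and $u_0$.* On the symmetric algebra $S^*_A(M)$ of $A\otimes_{\mathbb Z} M$ (for $A=\mathbb Z$ or $A=R$) let $\Delta^{a}_\alpha(f)=(f-s_\alpha(f))/\alpha$, and let $\Delta^{a}_{w_0}$ be the composition of these operators along a reduced decomposition of $w_0$ (it does not depend on the decomposition). The torsion index $\tau$ is the positive generator of the subgroup $\Delta^{a}_{w_0}(S^N_{\mathbb Z}(M))$ of $\mathbb Z$. Let $u_0\in\mathcal I_F^N$ be any element whose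 class in $\mathcal I_F^N/\mathcal I_F^{N+1}$ is $\phi(a)$ for some $a\in S^N_R(M)$ with $\Delta^{a}_{w_0}(a)=\tau$, where $\phi\colon S_R^*(M)\to\bigoplus_i\mathcal I_F^i/\mathcal I_F^{i+1}$ is the homomorphism of graded $R$-algebras sending $\lambda\in M$ to the class of $x_\lambda$. **Theorem.** Assume that $R$ has no $2$-torsion and that $\tau$ is invertible in $R$. Choose a reduced decomposition $I_w$ of every $w\in W$. Then the family $(\Delta_{I_w}(u_0))_{w\in W}$ is a basis of $R[\![M]\!]_F$ as an $R[\![M]\!]_F^W$-module, and so is the family $(C_{I_w}(u_0))_{w\in W}$. -/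

import Mathlib

noncomputable section

open MvPolynomial TensorProduct

namespace FormalGroupRing

section Completion

variable (R : Type*) [CommRing R]

/-- The kernel of the augmentation `R[x_S] → R`, `x_s ↦ 0`. -/
def augIdeal (S : Type*) : Ideal (MvPolynomial S R) :=
  RingHom.ker (constantCoeff : MvPolynomial S R →+* R)

/-- The ring `R⟦x_S⟧`: the completion of the polynomial ring `R[x_S]` at the kernel of the
augmentation (`S` may be infinite). -/
abbrev CompletedPoly (S : Type*) : Type _ := AdicCompletion (augIdeal R S) (MvPolynomial S R)

/-- The fundamental system of open neighbourhoods of `0` of the completion `R⟦x_S⟧`: the kernels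
of the projections `R⟦x_S⟧ → R[x_S] / ker(aug) ^ n`. -/
def nhdIdeal (S : Type*) (n : ℕ) : Ideal (CompletedPoly R S) :=
  RingHom.ker (AdicCompletion.evalₐ (augIdeal R S) n)

/-- The closure of an ideal of `R⟦x_S⟧`: an element lies in the closure of `J` iff each of its
basic neighbourhoods meets `J`, that is, iff it lies in `J + nhdIdeal n` for all `n`. -/
def closureIdeal {S : Type*} (J : Ideal (CompletedPoly R S)) : Ideal (CompletedPoly R S) :=
  ⨅ n, J ⊔ nhdIdeal R S n

variable {R} {S : Type*}

/-- The sum of the terms of total degree `< n` of the series `G(x_s, x_t)`. -/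
def partialSum (G : MvPowerSeries (Fin 2) R) (s t : S) (n : ℕ) : MvPolynomial S R :=
  ∑ d ∈ Finset.range n, ∑ ij ∈ Finset.HasAntidiagonal.antidiagonal d,
    C (MvPowerSeries.coeff (Finsupp.single 0 ij.1 + Finsupp.single 1 ij.2) G) *
      (X s ^ ij.1 * X t ^ ij.2)

theorem X_mem_augIdeal (s : S) : (X s : MvPolynomial S R) ∈ augIdeal R S := by
  simp [augIdeal, RingHom.mem_ker]

theorem partialSum_succ_sub_mem (G : MvPowerSeries (Fin 2) R) (s t : S) (n : ℕ) :
    partialSum G s t (n + 1) - partialSum G s t n ∈ augIdeal R S ^ n := by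
  unfold partialSum
  rw [Finset.sum_range_succ, add_sub_cancel_left]
  refine Ideal.sum_mem _ fun ij hij => Ideal.mul_mem_left _ _ ?_
  rw [← Finset.HasAntidiagonal.mem_antidiagonal.1 hij, pow_add]
  exact Ideal.mul_mem_mul (Ideal.pow_mem_pow (X_mem_augIdeal s) _)
    (Ideal.pow_mem_pow (X_mem_augIdeal t) _)

/-- The specialization `G(x_s, x_t) ∈ R⟦x_S⟧` of a power series `G` in two variables: the limit
of its partial sums. -/
def specialize (G : MvPowerSeries (Fin 2) R) (s t : S) : CompletedPoly R S :=
  AdicCompletion.mk (augIdeal R S) (MvPolynomial S R)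
    (AdicCompletion.AdicCauchySequence.mk _ _ (partialSum G s t) fun n => by
      rw [SModEq.comm, SModEq.sub_mem]
      simpa using partialSum_succ_sub_mem G s t n)

theorem evalₐ_specialize (G : MvPowerSeries (Fin 2) R) (s t : S) (n : ℕ) :
    AdicCompletion.evalₐ (augIdeal R S) n (specialize G s t) =
      Ideal.Quotient.mk _ (partialSum G s t n) :=
  AdicCompletion.evalₐ_mk _ n _

/-- The variable `x_s` of `R⟦x_S⟧`. -/
def var (s : S) : CompletedPoly R S := algebraMap (MvPolynomial S R) (CompletedPoly R S) (X s)

theorem evalₐ_var (s : S) (n : ℕ) :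
    AdicCompletion.evalₐ (augIdeal R S) n (var s) = Ideal.Quotient.mk _ (X s) := by
  rw [var, AlgHom.commutes]; rfl

variable (R) in
/-- The augmentation `R⟦x_S⟧ → R`. -/
def completedAug (S : Type*) : CompletedPoly R S →+* R :=
  (Ideal.Quotient.lift (augIdeal R S ^ 1) (constantCoeff : MvPolynomial S R →+* R)
    fun p hp => by simpa [augIdeal, RingHom.mem_ker] using hp).comp
    (AdicCompletion.evalₐ (augIdeal R S) 1 : CompletedPoly R S →+* _)

variable {T : Type*}

theorem rename_mem_augIdeal (f : S → T) :
    augIdeal R S ≤ (augIdeal R T).comap (rename f : MvPolynomial S R →ₐ[R] MvPolynomial T R) := by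
  intro p hp
  simpa [augIdeal, RingHom.mem_ker] using hp

theorem rename_pow_le (f : S → T) (n : ℕ) :
    augIdeal R S ^ n ≤
      (augIdeal R T ^ n).comap
        ((rename f : MvPolynomial S R →ₐ[R] MvPolynomial T R) : _ →+* _) :=
  le_trans (Ideal.pow_right_mono (rename_mem_augIdeal f) n) (Ideal.le_comap_pow _ n)

/-- The map `R[x_S] / ker(aug) ^ n → R[x_T] / ker(aug) ^ n` induced by `x_s ↦ x_{f s}`. -/
def quotRename (f : S → T) (n : ℕ) :
    (MvPolynomial S R ⧸ augIdeal R S ^ n) →+* (MvPolynomial T R ⧸ augIdeal R T ^ n) :=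
  Ideal.quotientMap (augIdeal R T ^ n)
    ((rename f : MvPolynomial S R →ₐ[R] MvPolynomial T R) : _ →+* _) (rename_pow_le f n)

theorem quotRename_compat (f : S → T) {m n : ℕ} (hle : m ≤ n) :
    (Ideal.Quotient.factorPow (augIdeal R T) hle).comp ((quotRename f n).comp
      (AdicCompletion.evalₐ (augIdeal R S) n : CompletedPoly R S →+* _)) =
    (quotRename f m).comp (AdicCompletion.evalₐ (augIdeal R S) m : CompletedPoly R S →+* _) := by
  ext x
  obtain ⟨x, rfl⟩ := AdicCompletion.mk_surjective (augIdeal R S) (MvPolynomial S R) x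
  simp only [RingHom.comp_apply, RingHom.coe_coe, AdicCompletion.evalₐ_mk, quotRename,
    Ideal.quotientMap_mk]
  change Ideal.Quotient.mk _ _ = _
  rw [Ideal.Quotient.mk_eq_mk_iff_sub_mem, ← map_sub]
  refine rename_pow_le f m ?_
  have := x.property hle
  rw [SModEq.comm, SModEq.sub_mem] at this
  simpa using this

/-- The continuous ring homomorphism `R⟦x_S⟧ → R⟦x_T⟧` sending `x_s` to `x_{f s}`. -/
def completedRename (f : S → T) : CompletedPoly R S →+* CompletedPoly R T :=
  AdicCompletion.liftRingHom (augIdeal R T)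
    (fun n => (quotRename f n).comp
      (AdicCompletion.evalₐ (augIdeal R S) n : CompletedPoly R S →+* _))
    (quotRename_compat f)

theorem evalₐ_completedRename (f : S → T) (n : ℕ) (x : CompletedPoly R S) :
    AdicCompletion.evalₐ (augIdeal R T) n (completedRename f x) =
      quotRename f n (AdicCompletion.evalₐ (augIdeal R S) n x) :=
  AdicCompletion.evalₐ_liftRingHom (augIdeal R T) _ (quotRename_compat f) n x

theorem completedRename_var (f : S → T) (s : S) :
    completedRename f (var s : CompletedPoly R S) = var (f s) := by
  refine AdicCompletion.ext_evalₐ fun n => ?_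
  rw [evalₐ_completedRename, evalₐ_var, evalₐ_var]
  simp [quotRename]

theorem completedRename_specialize (f : S → T) (G : MvPowerSeries (Fin 2) R) (s t : S) :
    completedRename f (specialize G s t) = specialize G (f s) (f t) := by
  refine AdicCompletion.ext_evalₐ fun n => ?_
  rw [evalₐ_completedRename, evalₐ_specialize, evalₐ_specialize]
  simp [quotRename, partialSum]

theorem completedRename_nhd (f : S → T) (n : ℕ) :
    nhdIdeal R S n ≤ (nhdIdeal R T n).comap (completedRename f) := by
  intro x hx
  rw [nhdIdeal, RingHom.mem_ker] at hx
  rw [Ideal.mem_comap, nhdIdeal, RingHom.mem_ker, evalₐ_completedRename, hx, map_zero]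

end Completion

section FormalGroupRing

variable {R : Type*} [CommRing R] (F : FormalGroup R) (M : Type*) [AddCommGroup M]

/-- The ideal of `R⟦x_M⟧` generated by `x_0` and the `x_{λ+μ} - F(x_λ, x_μ)`. -/
def relIdeal : Ideal (CompletedPoly R M) :=
  Ideal.span ({var 0} ∪
    {z | ∃ l m : M, z = var (l + m) - specialize F.toPowerSeries l m})

/-- The formal group ring `R⟦M⟧_F`. -/
abbrev FGR : Type _ := CompletedPoly R M ⧸ closureIdeal R (relIdeal F M)

variable {M}

/-- The class `x_λ ∈ R⟦M⟧_F`. -/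
def x (l : M) : FGR F M := Ideal.Quotient.mk _ (var l)

variable (M)

theorem closure_le_ker_aug :
    closureIdeal R (relIdeal F M) ≤ RingHom.ker (completedAug R M) := by
  refine (iInf_le _ 1).trans (sup_le ?_ ?_)
  · refine Ideal.span_le.2 ?_
    rintro z (rfl | ⟨l, m, rfl⟩)
    · simp [completedAug, RingHom.mem_ker, evalₐ_var]
    · have h : (0 : Fin 2 →₀ ℕ) = Finsupp.single 0 0 + Finsupp.single 1 0 := by simp
      have h0 := F.zero_constantCoeff
      rw [← MvPowerSeries.coeff_zero_eq_constantCoeff_apply] at h0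
      simp [completedAug, RingHom.mem_ker, evalₐ_var, evalₐ_specialize, partialSum, h0]
  · intro z hz
    rw [nhdIdeal, RingHom.mem_ker] at hz
    simp [completedAug, RingHom.mem_ker, hz]

/-- The augmentation `R⟦M⟧_F → R`. -/
def aug : FGR F M →+* R :=
  Ideal.Quotient.lift _ (completedAug R M) fun _ ha => closure_le_ker_aug F M ha

/-- The augmentation ideal `I_F` of `R⟦M⟧_F`. -/
def IF : Ideal (FGR F M) := RingHom.ker (aug F M)

variable {M} {M' : Type*} [AddCommGroup M']

theorem closure_le_comap (f : M →+ M') :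
    closureIdeal R (relIdeal F M) ≤
      (closureIdeal R (relIdeal F M')).comap (completedRename f) := by
  intro z hz
  simp only [closureIdeal, Ideal.mem_comap, Submodule.mem_iInf] at hz ⊢
  intro n
  refine (sup_le ?_ ?_ : relIdeal F M ⊔ nhdIdeal R M n ≤
    (relIdeal F M' ⊔ nhdIdeal R M' n).comap (completedRename f)) (hz n)
  · refine Ideal.span_le.2 ?_
    rintro z (rfl | ⟨l, m, rfl⟩)
    · rw [SetLike.mem_coe, Ideal.mem_comap, completedRename_var, map_zero]
      exact Ideal.mem_sup_left (Ideal.subset_span (Or.inl rfl))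
    · rw [SetLike.mem_coe, Ideal.mem_comap, map_sub, completedRename_var,
        completedRename_specialize, map_add]
      exact Ideal.mem_sup_left (Ideal.subset_span (Or.inr ⟨_, _, rfl⟩))
  · exact (completedRename_nhd f n).trans (Ideal.comap_mono le_sup_right)

/-- Functoriality in the group: `R⟦M⟧_F → R⟦M'⟧_F`, `x_λ ↦ x_{f λ}`. -/
def hat (f : M →+ M') : FGR F M →+* FGR F M' :=
  Ideal.quotientMap _ (completedRename f) (closure_le_comap F f)

end FormalGroupRing

section Quotient

open Classical in
/-- The quotient `a / b` in a commutative ring. It is only used for `b` regular and `a` divisible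
by `b`, where it is the unique `v` with `v * b = a`. -/
def exactQuot {A : Type*} [CommRing A] (a b : A) : A :=
  if h : ∃ v, v * b = a then h.choose else 0

theorem exactQuot_mul {A : Type*} [CommRing A] {a b : A} (h : ∃ v, v * b = a) :
    exactQuot a b * b = a := by
  rw [exactQuot, dif_pos h]; exact h.choose_spec

end Quotient

section RootDatum

variable {ι M N : Type*} [AddCommGroup M] [AddCommGroup N] (P : RootDatum ι M N) (b : P.Base)
variable {R : Type*} [CommRing R] (F : FormalGroup R)

/-- The action of an element of the Weyl group on `R⟦M⟧_F`. -/
def weylAct (w : P.weylGroup) : FGR F M →+* FGR F M :=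
  hat F (DistribSMul.toAddMonoidHom M w)

/-- The subring `R⟦M⟧_F^W` of invariants of the Weyl group. -/
def invariants : Subring (FGR F M) where
  carrier := {u | ∀ w : P.weylGroup, weylAct P F w u = u}
  mul_mem' ha hb w := by rw [map_mul, ha w, hb w]
  one_mem' w := map_one _
  add_mem' ha hb w := by rw [map_add, ha w, hb w]
  zero_mem' w := map_zero _
  neg_mem' ha w := by rw [map_neg, ha w]

/-- The reflection `s_α` acting on `R⟦M⟧_F`. -/
def refl (i : ι) : FGR F M →+* FGR F M := hat F (P.reflection i : M →+ M)

/-- The operator `Δ_α(u) = (u - s_α(u)) / x_α` on `R⟦M⟧_F`. -/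
def Del (i : ι) (u : FGR F M) : FGR F M := exactQuot (u - refl P F i u) (x F (P.root i))

/-- The power series `g` with `F(X, Y) = X + Y - X Y g(X, Y)`. -/
def gSeries : MvPowerSeries (Fin 2) R := fun d =>
  -MvPowerSeries.coeff (d + Finsupp.single 0 1 + Finsupp.single 1 1) F.toPowerSeries

/-- The element `e_α = g(x_α, x_{-α})`. -/
def eElt (i : ι) : FGR F M :=
  Ideal.Quotient.mk _ (specialize (gSeries F) (P.root i) (-P.root i))

/-- The operator `C_α(u) = u e_α - Δ_α(u)` on `R⟦M⟧_F`. -/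
def COp (i : ι) (u : FGR F M) : FGR F M := u * eElt P F i - Del P F i u

variable {P}

/-- The product `s_{i_1} ⋯ s_{i_l}` of simple reflections of a sequence `I = (i_1, …, i_l)`. -/
def wordProd (I : List b.support) : P.weylGroup :=
  (I.map fun i => RootPairing.weylGroup.ofIdx P i).prod

/-- The length of an element of the Weyl group with respect to the simple reflections. -/
def length (w : P.weylGroup) : ℕ := sInf {n | ∃ I : List b.support, I.length = n ∧ wordProd b I = w}

/-- `I` is a reduced decomposition of `w`. -/
def IsReducedDecomp (w : P.weylGroup) (I : List b.support) : Prop :=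
  wordProd b I = w ∧ I.length = length b w

/-- `w₀` is the longest element of the Weyl group. -/
def IsLongest (w₀ : P.weylGroup) : Prop := ∀ w : P.weylGroup, length b w ≤ length b w₀

/-- The composition `Δ_I = Δ_{i_1} ∘ ⋯ ∘ Δ_{i_l}`. -/
def DelWord (I : List b.support) (u : FGR F M) : FGR F M :=
  I.foldr (fun i v => Del P F (i : ι) v) u

/-- The composition `C_I = C_{i_1} ∘ ⋯ ∘ C_{i_l}`. -/
def CWord (I : List b.support) (u : FGR F M) : FGR F M :=
  I.foldr (fun i v => COp P F (i : ι) v) u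

/-- The symmetric algebra `S_R^*(M)` of `R ⊗ M`. -/
abbrev SymR (R M : Type*) [CommRing R] [AddCommGroup M] : Type _ := SymmetricAlgebra R (R ⊗[ℤ] M)

variable (R) in
/-- The element of `S_R^1(M)` given by `λ ∈ M`. -/
def symVar (l : M) : SymR R M := SymmetricAlgebra.ι R (R ⊗[ℤ] M) (1 ⊗ₜ l)

variable (P R) in
/-- The reflection `s_α` acting on `S_R^*(M)`. -/
def symRefl (i : ι) : SymR R M →ₐ[R] SymR R M :=
  SymmetricAlgebra.lift
    (SymmetricAlgebra.ι R (R ⊗[ℤ] M) ∘ₗ (P.reflection i : M →ₗ[ℤ] M).baseChange R)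

variable (P R) in
/-- The classical (additive) operator `Δ_α(a) = (a - s_α(a)) / α` on `S_R^*(M)`. -/
def symDel (i : ι) (a : SymR R M) : SymR R M :=
  exactQuot (a - symRefl P R i a) (symVar R (P.root i))

/-- The composition of the classical operators along a sequence of simple roots. -/
def symDelWord (R : Type*) [CommRing R] (I : List b.support) (a : SymR R M) : SymR R M :=
  I.foldr (fun i v => symDel P R (i : ι) v) a

/-- The homogeneous part `S_R^n(M)`. -/
def symDeg (R M : Type*) [CommRing R] [AddCommGroup M] (n : ℕ) : Submodule R (SymR R M) :=
  LinearMap.range (SymmetricAlgebra.ι R (R ⊗[ℤ] M)) ^ n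

/-- The subgroup `Δ_{w₀}(S^N(M))` of `ℤ = S^0(M)`, where `w₀` is the longest element of the Weyl
group and `N` its length. Classically `Δ_{w₀} = Δ_I` for every reduced decomposition `I`
of `w₀`. -/
def torsionSubgroup : AddSubgroup ℤ :=
  AddSubgroup.closure {c | ∃ (w₀ : P.weylGroup) (I : List b.support) (a : SymR ℤ M),
    IsLongest b w₀ ∧ IsReducedDecomp b w₀ I ∧ a ∈ symDeg ℤ M I.length ∧
      symDelWord b ℤ I a = algebraMap ℤ (SymR ℤ M) c}

/-- The torsion index of the root datum: the positive generator of `Δ_{w₀}(S^N(M)) ⊆ ℤ`,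
that is, the order of the quotient `ℤ / Δ_{w₀}(S^N(M))`. -/
def torsionIndex : ℕ := (torsionSubgroup b).index

/-- `GradedClass F n a u` says that `u ∈ I_F^n` and that the class of `u` in `I_F^n / I_F^{n+1}`
is the image of `a ∈ S_R^n(M)` under the graded ring homomorphism
`φ : S_R^*(M) → ⨁ I_F^i / I_F^{i+1}` that sends `λ ∈ M` to the class of `x_λ`: for any way of
writing `a` as a homogeneous polynomial `p` of degree `n` in elements of `M`, `φ(a)` is the class
of the same polynomial `p` in the `x_λ`. -/
def GradedClass (n : ℕ) (a : SymR R M) (u : FGR F M) : Prop :=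
  a ∈ symDeg R M n ∧ u ∈ IF F M ^ n ∧
    ∃ p : MvPolynomial M R, p.IsHomogeneous n ∧ aeval (symVar R) p = a ∧
      u - aeval (x F) p ∈ IF F M ^ (n + 1)

/-- The condition on the element `u₀`: it lies in `I_F^N`, and its class in `I_F^N / I_F^{N+1}` is
`φ(a)` for some `a ∈ S_R^N(M)` with `Δ_{w₀}(a) = τ`, where `w₀` is the longest element of the Weyl
group, `N` its length and `τ` the torsion index. -/
def IsTorsionLift (u₀ : FGR F M) : Prop :=
  ∃ (w₀ : P.weylGroup) (I₀ : List b.support) (a : SymR R M),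
    IsLongest b w₀ ∧ IsReducedDecomp b w₀ I₀ ∧
      symDelWord b R I₀ a = algebraMap R (SymR R M) (torsionIndex b : R) ∧
      GradedClass F I₀.length a u₀

end RootDatum

end FormalGroupRing

end

noncomputable section

open MvPolynomial TensorProduct

namespace FormalGroupRing

open RootPairing

/-! ### Action of the Weyl group on the roots -/

section WeylGroup

variable {ι M N : Type*} [AddCommGroup M] [AddCommGroup N] (P : RootDatum ι M N)

/-! Both families consist of words in operators `T_i(u) = u e_i + c Δ_i(u)` with `c = ±1`, so one
criterion serves both. Form the matrix `D` with entries `T_{I_v}(T_{I_w}(u₀))`. If `det D` is a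
unit, the family is a basis over the invariants (`exists_basis_of_isUnit_det`): each word is, up to
a regular denominator, a linear combination of elements of `W`, so `diag(y) D = Q E` where `E` has
entries `v(T_{I_w}(u₀))`. Then `Q` and `E` have regular determinants, and the solution `z` of `D z =
(T_{I_v}(u))_v` is the vector of coordinates of `u`, invariant by uniqueness.

An element of the formal group ring is a unit as soon as its augmentation is, so `det D` only
matters in `R`. Each `T_i` lowers the `I_F`-adic filtration by at most one and acts on leading terms
as `c` times the classical divided difference (`HasSymbol.word`). Since `u₀` lies in `I_F^N`, the
entry at `(v, w)` augments to `0` if `ℓ(v) + ℓ(w) < N`. If the sum is `N`, it augments to `c^N`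
times the classical composition along the concatenated word, applied to `a`: this is `c^N τ` if `v w
= w₀` and `0` otherwise, because classical compositions depend only on the product and vanish on
nonreduced words (`symDelWord_eq_and_eq_zero`). Matching the column `w` with the row `w₀ w⁻¹` and
ordering by length makes the matrix triangular with diagonal `c^N τ` (`isUnit_det_of_triangular`).

Two inputs need work. Independence of the word is deduced, without braid relations, from a
commutation rule with linear forms and from the inversion sets of reduced words. Regularity of `x_α`
(`x_mem_nonZeroDivisors`) comes from points of `F`: a basis of `M` gives a homomorphism from `M` to
the power series without constant term under the group law `F`, and it detects leading forms. -/

theorem weylGroup_smul_root (w : P.weylGroup) (i : ι) : w • P.root i = P.root (w • i) :=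
  weylGroup_apply_root P w i

theorem ofIdx_smul_eq_reflection (i : ι) (m : M) :
    weylGroup.ofIdx P i • m = P.reflection i m := rfl

theorem weylGroup_ext {w v : P.weylGroup} (h : ∀ m : M, w • m = v • m) : w = v :=
  Subtype.ext (Equiv.weightHom_injective P (LinearEquiv.ext h))

theorem ofIdx_mul_self (i : ι) : weylGroup.ofIdx P i * weylGroup.ofIdx P i = 1 := by
  refine weylGroup_ext P fun m => ?_
  rw [mul_smul, ofIdx_smul_eq_reflection, ofIdx_smul_eq_reflection, one_smul]
  simp

theorem ofIdx_inv (i : ι) : (weylGroup.ofIdx P i)⁻¹ = weylGroup.ofIdx P i :=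
  inv_eq_of_mul_eq_one_left (ofIdx_mul_self P i)

theorem ofIdx_mul_cancel (i : ι) (w : P.weylGroup) :
    weylGroup.ofIdx P i * (weylGroup.ofIdx P i * w) = w := by
  rw [← mul_assoc, ofIdx_mul_self, one_mul]

theorem ofIdx_smul_cancel {X : Type*} [MulAction P.weylGroup X] (i : ι) (y : X) :
    weylGroup.ofIdx P i • weylGroup.ofIdx P i • y = y := by
  rw [← mul_smul, ofIdx_mul_self, one_smul]

/-- The index of the negative of a root. -/
def negIdx (i : ι) : ι := P.reflectionPerm i i

theorem root_negIdx (i : ι) : P.root (negIdx P i) = -P.root i := by simp [negIdx]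

theorem smul_negIdx (w : P.weylGroup) (i : ι) : w • negIdx P i = negIdx P (w • i) := by
  apply P.root.injective
  rw [← weylGroup_smul_root, root_negIdx, root_negIdx, smul_neg, weylGroup_smul_root]

theorem ofIdx_smul_self (i : ι) : weylGroup.ofIdx P i • i = negIdx P i := rfl

theorem ofIdx_smul_index (w : P.weylGroup) (i : ι) :
    weylGroup.ofIdx P (w • i) = w * weylGroup.ofIdx P i * w⁻¹ := by
  obtain ⟨g, hg⟩ := w
  induction hg using weylGroup.induction generalizing i with
  | mem j =>
    change weylGroup.ofIdx P (weylGroup.ofIdx P j • i) =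
      weylGroup.ofIdx P j * weylGroup.ofIdx P i * (weylGroup.ofIdx P j)⁻¹
    rw [ofIdx_inv]
    refine weylGroup_ext P fun m => ?_
    change P.reflection (P.reflectionPerm j i) m = _
    rw [reflection_reflectionPerm]
    rfl
  | one =>
    change weylGroup.ofIdx P ((1 : P.weylGroup) • i) = (1 : P.weylGroup) * _ * (1 : P.weylGroup)⁻¹
    simp
  | mul x y hx hy h1 h2 =>
    have : (⟨x * y, mul_mem hx hy⟩ : P.weylGroup) = ⟨x, hx⟩ * ⟨y, hy⟩ := rfl
    rw [this, mul_smul, h1, h2]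
    group

theorem ofIdx_negIdx (i : ι) : weylGroup.ofIdx P (negIdx P i) = weylGroup.ofIdx P i := by
  rw [← ofIdx_smul_self, ofIdx_smul_index]
  simp [ofIdx_inv, ofIdx_mul_self]

variable [Module.Free ℤ M]

/-- Expanding both sides of `s_{wα}(w m) = w s_α(m)` gives two multiples of the root `wα`; it is
nonzero in a torsion-free group, so the coefficients agree. -/
theorem coroot'_smul (w : P.weylGroup) (i : ι) (m : M) :
    P.coroot' (w • i) (w • m) = P.coroot' i m := by
  have h : weylGroup.ofIdx P (w • i) • w • m = w • weylGroup.ofIdx P i • m := by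
    rw [ofIdx_smul_index]; simp [mul_smul]
  rw [ofIdx_smul_eq_reflection, ofIdx_smul_eq_reflection, reflection_apply, reflection_apply,
    smul_sub, ← weylGroup_smul_root, sub_right_inj] at h
  have h2 : w • (P.coroot' i m • P.root i) = P.coroot' i m • w • P.root i := by
    exact smul_comm w.1 _ _
  rw [h2] at h
  exact smul_left_injective ℤ (by rw [weylGroup_smul_root]; exact P.ne_zero _) h

theorem coroot'_inv_smul (w : P.weylGroup) (i : ι) (m : M) :
    P.coroot' (w⁻¹ • i) m = P.coroot' i (w • m) := by
  rw [← coroot'_smul P w, smul_inv_smul]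

end WeylGroup

/-! ### Reduced words, inversions and the exchange property -/

section Words

variable {ι M N : Type*} [AddCommGroup M] [AddCommGroup N] {P : RootDatum ι M N} (b : P.Base)

@[simp] theorem wordProd_nil : wordProd b [] = 1 := rfl

@[simp] theorem wordProd_cons (i : b.support) (I : List b.support) :
    wordProd b (i :: I) = weylGroup.ofIdx P (i : ι) * wordProd b I := rfl

@[simp] theorem wordProd_append (I J : List b.support) :
    wordProd b (I ++ J) = wordProd b I * wordProd b J := by simp [wordProd]

theorem length_wordProd_le (I : List b.support) : length b (wordProd b I) ≤ I.length :=
  Nat.sInf_le ⟨I, rfl, rfl⟩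

/-- A word is reduced if its number of letters is the length of its product. -/
def IsReduced (I : List b.support) : Prop := I.length = length b (wordProd b I)

variable {b} in
theorem IsReduced.le {I J : List b.support} (h : IsReduced b I) (hJ : wordProd b J = wordProd b I) :
    I.length ≤ J.length := by
  rw [h, ← hJ]; exact length_wordProd_le b J

variable {b} in
theorem isReduced_iff_le {I : List b.support} :
    IsReduced b I ↔ ∀ J, wordProd b J = wordProd b I → I.length ≤ J.length := by
  refine ⟨fun h J hJ => h.le hJ, fun h => le_antisymm ?_ (length_wordProd_le b I)⟩
  have : (length b (wordProd b I)) ∈ _ := Nat.sInf_mem ⟨I.length, I, rfl, rfl⟩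
  obtain ⟨J, hJ, hJ'⟩ := this
  exact (h J hJ').trans hJ.le

theorem exists_isReduced_wordProd (I : List b.support) :
    ∃ J, IsReduced b J ∧ wordProd b J = wordProd b I := by
  have : (length b (wordProd b I)) ∈ _ := Nat.sInf_mem ⟨I.length, I, rfl, rfl⟩
  obtain ⟨J, hJ, hJ'⟩ := this
  exact ⟨J, by rw [IsReduced, hJ, hJ'], hJ'⟩

variable {b} in
theorem IsReduced.tail {i : b.support} {I : List b.support} (h : IsReduced b (i :: I)) :
    IsReduced b I := by
  rw [isReduced_iff_le] at h ⊢
  intro J hJ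
  simpa using h (i :: J) (by simp [hJ])

/-- The list of the pairs `(γ, K)` where `K` is obtained by deleting a letter of the word `I`, and
`γ` is the root with `wordProd K = wordProd I * s_γ` that comes from this letter. -/
def deletions : List b.support → List (ι × List b.support)
  | [] => []
  | i :: I => ((wordProd b I)⁻¹ • (i : ι), I) ::
      (deletions I).map fun q => (q.1, i :: q.2)

/-- The roots of the deletions of a word. -/
def inversions (I : List b.support) : List ι := (deletions b I).map Prod.fst

@[simp] theorem inversions_nil : inversions b [] = [] := rfl

@[simp] theorem inversions_cons (i : b.support) (I : List b.support) :
    inversions b (i :: I) = ((wordProd b I)⁻¹ • (i : ι)) :: inversions b I := by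
  simp [inversions, deletions, Function.comp_def]

/-- Removing the letter `i` from `A i B` multiplies the product on the right by `B⁻¹ s_i B`, the
reflection in `B⁻¹ α_i`. -/
theorem deletions_spec {I : List b.support} {q : ι × List b.support} (hq : q ∈ deletions b I) :
    q.2.length + 1 = I.length ∧ wordProd b q.2 = wordProd b I * weylGroup.ofIdx P q.1 := by
  induction I generalizing q with
  | nil => simp [deletions] at hq
  | cons i I ih =>
    rw [deletions, List.mem_cons, List.mem_map] at hq
    obtain rfl | ⟨q, hq, rfl⟩ := hq
    · refine ⟨rfl, ?_⟩
      simp only [wordProd_cons, ofIdx_smul_index, inv_inv]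
      rw [← mul_assoc, ← mul_assoc, mul_assoc (weylGroup.ofIdx P (i : ι)), mul_inv_cancel, mul_one,
        ofIdx_mul_self, one_mul]
    · obtain ⟨h1, h2⟩ := ih hq
      refine ⟨by simp [h1], ?_⟩
      simp only [wordProd_cons, h2, mul_assoc]

theorem isPos_negIdx_iff (j : ι) : b.IsPos (negIdx P j) ↔ ¬ b.IsPos j := Base.IsPos.neg_iff_not b j

theorem isPos_simple (i : b.support) : b.IsPos i := Base.isPos_of_mem_support i.2

variable [Finite ι] [P.IsReduced]

variable {b} in
theorem isPos_ofIdx_smul {i : b.support} {j : ι} (hj : b.IsPos j) (hij : j ≠ i) :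
    b.IsPos (weylGroup.ofIdx P (i : ι) • j) := hj.reflectionPerm i.2 hij

/-- Reading the word from the right, the root changes sign at some letter `i`. Among positive roots
`s_i` makes only `α_i` negative, so the root is `α_i` at that moment. The word need not be reduced.
-/
theorem mem_inversions_of_isPos {I : List b.support} {j : ι} (hj : b.IsPos j)
    (hw : ¬ b.IsPos (wordProd b I • j)) : j ∈ inversions b I := by
  induction I with
  | nil => simp at hw; exact absurd hj hw
  | cons i I ih =>
    rw [inversions_cons, List.mem_cons]
    by_cases h : b.IsPos (wordProd b I • j)
    · left
      rw [eq_inv_smul_iff]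
      by_contra hne
      rw [wordProd_cons, mul_smul] at hw
      exact hw (isPos_ofIdx_smul h hne)
    · exact Or.inr (ih h)

/-- The exchange property: with `w` the product, `-w⁻¹ α_i` is a positive root made negative by `w`,
so it is the root of a deletion; this deletion multiplies `w` on the right by `w⁻¹ s_i w`. -/
theorem exists_shorter_of_not_isPos {I : List b.support} {i : b.support}
    (h : ¬ b.IsPos ((wordProd b I)⁻¹ • (i : ι))) :
    ∃ K : List b.support, K.length + 1 = I.length ∧
      wordProd b K = weylGroup.ofIdx P (i : ι) * wordProd b I := by
  have h1 : negIdx P ((wordProd b I)⁻¹ • (i : ι)) ∈ inversions b I := by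
    refine mem_inversions_of_isPos b ((isPos_negIdx_iff b _).2 h) ?_
    rw [smul_negIdx, smul_inv_smul, isPos_negIdx_iff, not_not]
    exact isPos_simple b i
  obtain ⟨q, hq, hq1⟩ := List.mem_map.1 h1
  obtain ⟨h2, h3⟩ := deletions_spec b hq
  refine ⟨q.2, h2, ?_⟩
  rw [h3, hq1, ofIdx_negIdx, ofIdx_smul_index]
  group

variable {b} in
-- Otherwise the exchange property for the tail yields a word for the same product with two letters
-- fewer.
theorem IsReduced.isPos_head {i : b.support} {I : List b.support} (h : IsReduced b (i :: I)) :
    b.IsPos ((wordProd b I)⁻¹ • (i : ι)) := by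
  by_contra hn
  obtain ⟨K, hK, hK'⟩ := exists_shorter_of_not_isPos b hn
  have := h.le (J := K) (by rw [hK', wordProd_cons])
  simp at this
  omega

theorem isReduced_cons_of_isPos {i : b.support} {I : List b.support} (hI : IsReduced b I)
    (h : b.IsPos ((wordProd b I)⁻¹ • (i : ι))) : IsReduced b (i :: I) := by
  obtain ⟨K, hK, hK'⟩ := exists_isReduced_wordProd b (i :: I)
  -- `K` is a reduced word of `s_i w`. Its inverse sends `α_i` to the negative of `w⁻¹ α_i`, so
  -- exchange gives a word of `w` with one letter less than `K`, whence `K` is longer than `I`.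
  have h1 : ¬ b.IsPos ((wordProd b K)⁻¹ • (i : ι)) := by
    rw [hK', wordProd_cons, mul_inv_rev, ofIdx_inv, mul_smul, ofIdx_smul_self, smul_negIdx,
      isPos_negIdx_iff, not_not]
    exact h
  obtain ⟨L, hL, hL'⟩ := exists_shorter_of_not_isPos b h1
  have h2 := hI.le (J := L) (by rw [hL', hK', wordProd_cons, ofIdx_mul_cancel])
  have h3 := length_wordProd_le b (i :: I)
  rw [← hK', ← hK] at h3
  have h4 : (i :: I).length ≤ K.length := by simp; omega
  rw [IsReduced, ← hK', ← hK]
  exact le_antisymm h4 h3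

variable {b} in
-- For reduced words the list of inversions is, up to order, an invariant of the product; this is
-- what replaces braid relations below. A repetition would contradict positivity of the root at the
-- head.
theorem IsReduced.inversions {I : List b.support} (h : IsReduced b I) :
    (inversions b I).Nodup ∧
      ∀ j, j ∈ inversions b I ↔ b.IsPos j ∧ ¬ b.IsPos (wordProd b I • j) := by
  induction I with
  | nil => simp
  | cons i I ih =>
    obtain ⟨ih1, ih2⟩ := ih h.tail
    have hpos := h.isPos_head
    refine ⟨?_, fun j => ⟨fun hj => ?_, fun hj => mem_inversions_of_isPos b hj.1 hj.2⟩⟩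
    · rw [inversions_cons, List.nodup_cons]
      refine ⟨fun hm => ?_, ih1⟩
      have := ((ih2 _).1 hm).2
      rw [smul_inv_smul] at this
      exact this (isPos_simple b i)
    · rw [inversions_cons, List.mem_cons] at hj
      obtain rfl | hj := hj
      · refine ⟨hpos, ?_⟩
        rw [wordProd_cons, mul_smul, smul_inv_smul, ofIdx_smul_self, isPos_negIdx_iff, not_not]
        exact isPos_simple b i
      · obtain ⟨h1, h2⟩ := (ih2 j).1 hj
        refine ⟨h1, fun h3 => ?_⟩
        rw [← isPos_negIdx_iff] at h2
        have h4 : negIdx P (wordProd b I • j) ≠ (i : ι) := by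
          intro h5
          rw [← h5, smul_negIdx, inv_smul_smul, isPos_negIdx_iff] at hpos
          exact hpos h1
        have h5 := isPos_ofIdx_smul h2 h4
        rw [smul_negIdx, isPos_negIdx_iff] at h5
        rw [wordProd_cons, mul_smul] at h3
        exact h5 h3

variable {b} in
theorem IsReduced.inversions_perm {I J : List b.support} (hI : IsReduced b I) (hJ : IsReduced b J)
    (h : wordProd b I = wordProd b J) : (FormalGroupRing.inversions b I).Perm
      (FormalGroupRing.inversions b J) := by
  rw [List.perm_ext_iff_of_nodup hI.inversions.1 hJ.inversions.1]
  intro j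
  rw [hI.inversions.2, hJ.inversions.2, h]

/-- If `s_i I` is not reduced but `I` is, then some reduced word of the same product starts
with `i`. -/
theorem exists_cons_of_not_isReduced {i : b.support} {I : List b.support} (hI : IsReduced b I)
    (h : ¬ IsReduced b (i :: I)) :
    ∃ K : List b.support, (i :: K).length = I.length ∧ wordProd b (i :: K) = wordProd b I := by
  have h1 : ¬ b.IsPos ((wordProd b I)⁻¹ • (i : ι)) := fun hp => h (isReduced_cons_of_isPos b hI hp)
  obtain ⟨K, hK, hK'⟩ := exists_shorter_of_not_isPos b h1
  exact ⟨K, hK, by rw [wordProd_cons, hK', ofIdx_mul_cancel]⟩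

end Words

/-! ### The longest element -/

section Longest

variable {ι M N : Type*} [AddCommGroup M] [AddCommGroup N] {P : RootDatum ι M N} (b : P.Base)

theorem length_one : length b 1 = 0 := Nat.le_zero.1 (length_wordProd_le b [])

variable {b} in
theorem IsReduced.isReducedDecomp {I : List b.support} (h : IsReduced b I) :
    IsReducedDecomp b (wordProd b I) I := ⟨rfl, h⟩

variable {b} in
theorem IsReducedDecomp.isReduced {w : P.weylGroup} {I : List b.support}
    (h : IsReducedDecomp b w I) : IsReduced b I := by
  rw [IsReduced, h.1, h.2]

theorem exists_isReducedDecomp (hgen : ∀ w, ∃ I, wordProd b I = w) (w : P.weylGroup) :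
    ∃ I, IsReducedDecomp b w I := by
  obtain ⟨I, rfl⟩ := hgen w
  obtain ⟨J, hJ, hJ'⟩ := exists_isReduced_wordProd b I
  exact ⟨J, hJ' ▸ hJ.isReducedDecomp⟩

theorem length_mul_le (hgen : ∀ w, ∃ I, wordProd b I = w) (v w : P.weylGroup) :
    length b (v * w) ≤ length b v + length b w := by
  obtain ⟨I, hI, hI'⟩ := exists_isReducedDecomp b hgen v
  obtain ⟨J, hJ, hJ'⟩ := exists_isReducedDecomp b hgen w
  rw [← hI', ← hJ', ← hI, ← hJ, ← wordProd_append, ← List.length_append]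
  exact length_wordProd_le b _

theorem length_ofIdx_le (i : b.support) : length b (weylGroup.ofIdx P (i : ι)) ≤ 1 := by
  simpa using length_wordProd_le b [i]

/-- The lengths of the elements of the Weyl group are bounded, so it is finite. -/
theorem finite_weylGroup (hgen : ∀ w, ∃ I, wordProd b I = w) {w₀ : P.weylGroup}
    (hw₀ : IsLongest b w₀) : Finite P.weylGroup := by
  choose I hI using exists_isReducedDecomp b hgen
  have hinj : Function.Injective I := fun v w h => by rw [← (hI v).1, h, (hI w).1]
  have := (List.finite_length_le b.support (length b w₀)).to_subtype
  refine Finite.of_injective (β := {l : List b.support | l.length ≤ length b w₀})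
    (fun w => ⟨I w, (hI w).2.trans_le (hw₀ w)⟩) fun v w h => hinj (by simpa using h)

theorem not_isPos_inv_smul {w : P.weylGroup} (hw : ∀ j, b.IsPos j → ¬ b.IsPos (w • j)) {j : ι}
    (hj : b.IsPos j) : ¬ b.IsPos (w⁻¹ • j) := fun h => by
  have := hw _ h
  rw [smul_inv_smul] at this
  exact this hj

variable [Finite ι]

/-- An element that makes all the simple roots negative makes all the positive roots negative. -/
theorem not_isPos_smul_of_forall_simple {w : P.weylGroup}
    (hw : ∀ i : b.support, ¬ b.IsPos (w • (i : ι))) {j : ι} (hj : b.IsPos j) :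
    ¬ b.IsPos (w • j) := by
  refine hj.induction_on_add (p := fun j => ¬ b.IsPos (w • j)) (fun i hi => hw ⟨i, hi⟩) fun i j k hk hi hj => ?_
  rw [← isPos_negIdx_iff] at hi ⊢
  refine hi.add ((isPos_negIdx_iff b _).2 (hw ⟨j, hj⟩)) ?_
  simp only [root_negIdx, ← weylGroup_smul_root, hk, smul_add, neg_add]

variable [P.IsReduced]

/-- If `v ≠ w`, a reduced word of `v⁻¹ w` has a first letter `i`, and then `w⁻¹ v α_i` is negative.
But `v` makes `α_i` negative and `w⁻¹` makes it positive again. -/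
theorem eq_of_forall_not_isPos (hgen : ∀ w, ∃ I, wordProd b I = w) {v w : P.weylGroup}
    (hv : ∀ j, b.IsPos j → ¬ b.IsPos (v • j)) (hw : ∀ j, b.IsPos j → ¬ b.IsPos (w • j)) :
    v = w := by
  obtain ⟨I, hI⟩ := exists_isReducedDecomp b hgen (v⁻¹ * w)
  cases I with
  | nil => simpa [inv_mul_eq_one] using hI.1.symm
  | cons i I =>
    exfalso
    have h1 := hI.isReduced.isPos_head
    have h2 : b.IsPos ((w⁻¹ * v) • (i : ι)) := by
      have h3 := hv i (isPos_simple b i)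
      rw [← isPos_negIdx_iff] at h3
      have h4 := not_isPos_inv_smul b hw h3
      rwa [smul_negIdx, isPos_negIdx_iff, not_not, ← mul_smul] at h4
    have h5 : w⁻¹ * v = (v⁻¹ * w)⁻¹ := by group
    rw [h5, ← hI.1, wordProd_cons, mul_inv_rev, ofIdx_inv, mul_smul, ofIdx_smul_self, smul_negIdx,
      isPos_negIdx_iff] at h2
    exact h2 h1

variable {b} in
-- It suffices to treat a simple root `α_i`; if `w₀⁻¹ α_i` were positive, `s_i w₀` would be longer
-- than `w₀`.
theorem IsLongest.not_isPos_inv_smul (hgen : ∀ w, ∃ I, wordProd b I = w) {w₀ : P.weylGroup}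
    (hw₀ : IsLongest b w₀) {j : ι} (hj : b.IsPos j) : ¬ b.IsPos (w₀⁻¹ • j) := by
  refine not_isPos_smul_of_forall_simple b (fun i hi => ?_) hj
  obtain ⟨I, hI⟩ := exists_isReducedDecomp b hgen w₀
  have h : IsReduced b (i :: I) := isReduced_cons_of_isPos b hI.isReduced (by rwa [hI.1])
  have h1 := hw₀ (wordProd b (i :: I))
  rw [← h, ← hI.2, List.length_cons] at h1
  omega

variable {b} in
theorem IsLongest.eq (hgen : ∀ w, ∃ I, wordProd b I = w) {v w : P.weylGroup}
    (hv : IsLongest b v) (hw : IsLongest b w) : v = w :=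
  inv_injective (eq_of_forall_not_isPos b hgen (fun _ => hv.not_isPos_inv_smul hgen)
    fun _ => hw.not_isPos_inv_smul hgen)

variable {b} in
-- Climb from `w` by left multiplication with simple reflections that raise the length. When none
-- does, `w⁻¹` makes all positive roots negative, which forces `w = w₀`.
theorem IsLongest.exists_mul_eq (hgen : ∀ w, ∃ I, wordProd b I = w) {w₀ : P.weylGroup}
    (hw₀ : IsLongest b w₀) (w : P.weylGroup) :
    ∃ v, v * w = w₀ ∧ length b v + length b w = length b w₀ := by
  by_cases h : ∃ i : b.support, b.IsPos (w⁻¹ • (i : ι))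
  · obtain ⟨i, hi⟩ := h
    obtain ⟨I, hI⟩ := exists_isReducedDecomp b hgen w
    have h1 : IsReduced b (i :: I) := isReduced_cons_of_isPos b hI.isReduced (by rwa [hI.1])
    have h2 : length b (weylGroup.ofIdx P (i : ι) * w) = length b w + 1 := by
      rw [← hI.2, ← hI.1, ← wordProd_cons, ← h1, List.length_cons]
    have h3 := hw₀ (weylGroup.ofIdx P (i : ι) * w)
    obtain ⟨v, hv, hv'⟩ := hw₀.exists_mul_eq hgen (weylGroup.ofIdx P (i : ι) * w)
    refine ⟨v * weylGroup.ofIdx P (i : ι), by rw [mul_assoc, hv], ?_⟩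
    -- Subadditivity bounds the length of `v s_i` from both sides: by `ℓ(v) + 1` above and by `ℓ(w₀)
    -- - ℓ(w)` below.
    have h4 := length_mul_le b hgen v (weylGroup.ofIdx P (i : ι))
    have h5 := length_ofIdx_le b i
    have h6 := length_mul_le b hgen (v * weylGroup.ofIdx P (i : ι)) w
    rw [mul_assoc, hv] at h6
    omega
  · push Not at h
    have : w = w₀ := inv_injective (eq_of_forall_not_isPos b hgen
      (fun j hj => not_isPos_smul_of_forall_simple b h hj)
      fun _ => hw₀.not_isPos_inv_smul hgen)
    subst this
    exact ⟨1, one_mul _, by simp [length_one]⟩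
termination_by length b w₀ - length b w

end Longest

/-! ### Divided differences in a commutative ring -/

section DividedDifference

variable {A : Type*} [CommRing A] (s : A →+* A) (y : A)

/-- The divided difference `a ↦ (a - s a) / y`. -/
def divDiff (a : A) : A := exactQuot (a - s a) y

variable {s y} (hdiv : ∀ a, ∃ v, v * y = a - s a)

include hdiv

theorem divDiff_mul_self (a : A) : divDiff s y a * y = a - s a := exactQuot_mul (hdiv a)

variable (hy : y ∈ nonZeroDivisors A)

include hy

theorem eq_divDiff {a v : A} (h : v * y = a - s a) : divDiff s y a = v :=
  (mul_cancel_right_mem_nonZeroDivisors hy).1 ((divDiff_mul_self hdiv a).trans h.symm)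

theorem divDiff_add (a c : A) : divDiff s y (a + c) = divDiff s y a + divDiff s y c :=
  eq_divDiff hdiv hy (by
    rw [add_mul, divDiff_mul_self hdiv, divDiff_mul_self hdiv, map_add]; ring)

theorem divDiff_mul (a c : A) :
    divDiff s y (a * c) = divDiff s y a * c + s a * divDiff s y c :=
  eq_divDiff hdiv hy (by
    rw [add_mul, mul_right_comm, mul_assoc (s a), divDiff_mul_self hdiv, divDiff_mul_self hdiv,
      map_mul]; ring)

theorem divDiff_of_fixed {a : A} (h : s a = a) : divDiff s y a = 0 :=
  eq_divDiff hdiv hy (by rw [h, zero_mul, sub_self])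

theorem divDiff_divDiff (hs : ∀ a, s (s a) = a) (hsy : s y = -y) (a : A) :
    divDiff s y (divDiff s y a) = 0 := by
  refine divDiff_of_fixed hdiv hy ?_
  -- Applying `s` to `v y = a - s(a)` changes the sign of `y` and of the right side, so `s(v) = v`
  -- by regularity.
  have h := congrArg s (divDiff_mul_self hdiv a)
  rw [map_mul, map_sub, hs, hsy] at h
  refine ((mul_cancel_right_mem_nonZeroDivisors hy).1 ?_).symm
  rw [divDiff_mul_self hdiv]
  linear_combination h

end DividedDifference

/-! ### Regularity of linear forms -/

section LinearForm

variable {R M σ : Type*} [CommRing R] [AddCommGroup M] [Fintype σ] (e : Module.Basis σ ℤ M)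

variable (R) in
/-- The linear form of an element of a free abelian group with a basis. -/
def linForm (m : M) : MvPolynomial σ R := ∑ i, C ((e.repr m i : ℤ) : R) * X i

/-- Substituting `X_i + f(e_i) T` for `X_i` turns the form into `2 T` plus a constant in `T`. Its
leading coefficient `2` is regular, so the image is regular; `T = 0` undoes the substitution, which
is therefore injective. -/
theorem linForm_mem_nonZeroDivisors (h2 : ∀ r : R, 2 * r = 0 → r = 0) (f : M →ₗ[ℤ] ℤ) {m : M}
    (hf : f m = 2) : linForm R e m ∈ nonZeroDivisors (MvPolynomial σ R) := by
  nontriviality R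
  obtain ⟨g, hgX, hgC⟩ : ∃ g : MvPolynomial σ R →+* Polynomial (MvPolynomial σ R),
      (∀ i, g (X i) =
        Polynomial.C (X i) + Polynomial.C (C ((f (e i) : ℤ) : R)) * Polynomial.X) ∧
      ∀ r, g (C r) = Polynomial.C (C r) :=
    ⟨eval₂Hom (Polynomial.C.comp C) _, fun i => eval₂Hom_X' _ _ _, fun r => eval₂Hom_C _ _ _⟩
  have hg : ∀ p, (g p).eval 0 = p := by
    intro p
    have : ((Polynomial.evalRingHom 0 : Polynomial (MvPolynomial σ R) →+* _).comp
        g) = RingHom.id _ := by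
      refine MvPolynomial.ringHom_ext (fun r => ?_) fun i => ?_
      · simp [hgC]
      · simp [hgX]
    exact congrArg (fun h => h p) this
  have hC2 : (C (2 : R) : MvPolynomial σ R) ∈ nonZeroDivisors (MvPolynomial σ R) := by
    rw [mem_nonZeroDivisors_iff_right]
    intro p hp
    ext d
    have := congrArg (coeff d) hp
    rw [mul_comm, coeff_C_mul] at this
    exact h2 _ this
  have hlin : g (linForm R e m) =
      Polynomial.C (C (2 : R)) * Polynomial.X + Polynomial.C (linForm R e m) := by
    have h3 : ∑ i, (e.repr m i) * f (e i) = 2 := by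
      rw [← hf]
      conv_rhs => rw [← e.sum_repr m, map_sum]
      simp
    have h4 : (C (2 : R) : MvPolynomial σ R) =
        ∑ i, C ((e.repr m i : ℤ) : R) * C ((f (e i) : ℤ) : R) := by
      have : ((2 : ℤ) : R) = 2 := by norm_num
      rw [← this, ← h3]
      simp
    rw [h4, linForm, map_sum, map_sum, map_sum, Finset.sum_mul, ← Finset.sum_add_distrib]
    refine Finset.sum_congr rfl fun i _ => ?_
    rw [map_mul, hgX, hgC, map_mul, map_mul]
    ring
  have hreg : g (linForm R e m) ∈ nonZeroDivisors (Polynomial (MvPolynomial σ R)) := by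
    refine Polynomial.mem_nonZeroDivisors_of_leadingCoeff ?_
    rw [hlin, Polynomial.leadingCoeff_linear (nonZeroDivisors.ne_zero hC2)]
    exact hC2
  rw [mem_nonZeroDivisors_iff_right]
  intro p hp
  have h5 := congrArg g hp
  rw [map_mul, map_zero] at h5
  rw [← hg p, (mem_nonZeroDivisors_iff_right.1 hreg) _ h5, Polynomial.eval_zero]

end LinearForm

/-! ### The symmetric algebra -/

section SymmetricAlgebra

variable {R M : Type*} [CommRing R] [AddCommGroup M]

theorem symVar_add (l m : M) : symVar R (l + m) = symVar R l + symVar R m := by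
  simp [symVar, TensorProduct.tmul_add]

variable (R M) in
/-- The additive map `l ↦ symVar l`. -/
def symVarHom : M →+ SymR R M := AddMonoidHom.mk' (symVar R) symVar_add

theorem map_sum_symVar {κ : Type*} (t : Finset κ) (l : κ → M) :
    ∑ i ∈ t, symVar R (l i) = symVar R (∑ i ∈ t, l i) := (map_sum (symVarHom R M) l t).symm

theorem symVar_zsmul (n : ℤ) (l : M) : symVar R (n • l) = n • symVar R l :=
  map_zsmul (symVarHom R M) n l

theorem symVar_sub (l m : M) : symVar R (l - m) = symVar R l - symVar R m :=
  map_sub (symVarHom R M) l m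

theorem symVar_neg (l : M) : symVar R (-l) = -symVar R l := map_neg (symVarHom R M) l

theorem SymR.induction {p : SymR R M → Prop} (h1 : ∀ r, p (algebraMap R _ r))
    (h2 : ∀ l, p (symVar R l)) (hmul : ∀ a c, p a → p c → p (a * c))
    (hadd : ∀ a c, p a → p c → p (a + c)) (a : SymR R M) : p a := by
  refine SymmetricAlgebra.induction R _ h1 (fun t => ?_) hmul hadd a
  induction t using TensorProduct.induction_on with
  | zero => rw [map_zero, ← map_zero (algebraMap R _)]; exact h1 0
  | tmul r l =>
    have : r ⊗ₜ[ℤ] l = r • ((1 : R) ⊗ₜ[ℤ] l) := by simp [TensorProduct.smul_tmul']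
    rw [this, map_smul, Algebra.smul_def]
    exact hmul _ _ (h1 r) (h2 l)
  | add t u ht hu => rw [map_add]; exact hadd _ _ ht hu

theorem algebraMap_symR_injective : Function.Injective (algebraMap R (SymR R M)) :=
  (SymmetricAlgebra.algebraMap_leftInverse (R := R) (R ⊗[ℤ] M)).injective

theorem symVar_mem_nonZeroDivisors [Module.Free ℤ M] [Module.Finite ℤ M]
    (h2 : ∀ r : R, 2 * r = 0 → r = 0) (f : M →ₗ[ℤ] ℤ) {m : M}
    (hf : f m = 2) : symVar R m ∈ nonZeroDivisors (SymR R M) := by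
  let e := Module.Free.chooseBasis ℤ M
  let E := SymmetricAlgebra.equivMvPolynomial (e.baseChange R)
  have hE : ∀ i, E (symVar R (e i)) = X i := fun i => by
    rw [symVar, ← Module.Basis.baseChange_apply, SymmetricAlgebra.equivMvPolynomial_ι_apply]
  have h : E (symVar R m) = linForm R e m := by
    have h1 : symVar R m = ∑ i, e.repr m i • symVar R (e i) := by
      conv_lhs => rw [← e.sum_repr m]
      rw [← map_sum_symVar]
      simp only [symVar_zsmul]
    rw [h1, linForm, map_sum]
    refine Finset.sum_congr rfl fun i _ => ?_
    rw [map_zsmul, hE, zsmul_eq_mul]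
    simp
  have h3 := linForm_mem_nonZeroDivisors e h2 f hf
  rw [← h] at h3
  exact mem_nonZeroDivisors_of_injective E.injective h3

end SymmetricAlgebra

/-! ### Classical divided differences -/

section SymDel

variable {ι M N : Type*} [AddCommGroup M] [AddCommGroup N] (P : RootDatum ι M N)
variable {R : Type*} [CommRing R]

theorem symRefl_symVar (i : ι) (l : M) :
    symRefl P R i (symVar R l) = symVar R (weylGroup.ofIdx P i • l) := by
  rw [symRefl, symVar, SymmetricAlgebra.lift_ι_apply, LinearMap.comp_apply,
    LinearMap.baseChange_tmul]
  rfl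

theorem coroot'_root_self (i : ι) : P.coroot' i (P.root i) = 2 := by simp

theorem ofIdx_smul_eq_sub (i : ι) (l : M) :
    weylGroup.ofIdx P i • l = l - P.coroot' i l • P.root i := by
  rw [ofIdx_smul_eq_reflection, reflection_apply]

theorem symRefl_symVar_sub (i : ι) (l : M) :
    P.coroot' i l • (1 : SymR R M) * symVar R (P.root i) =
      symVar R l - symRefl P R i (symVar R l) := by
  rw [symRefl_symVar, ofIdx_smul_eq_sub, symVar_sub, symVar_zsmul, sub_sub_cancel, smul_one_mul]

theorem symRefl_symRefl (i : ι) (a : SymR R M) : symRefl P R i (symRefl P R i a) = a := by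
  induction a using SymR.induction with
  | h1 r => simp
  | h2 l => rw [symRefl_symVar, symRefl_symVar, ofIdx_smul_cancel]
  | hmul a c ha hc => rw [map_mul, map_mul, ha, hc]
  | hadd a c ha hc => rw [map_add, map_add, ha, hc]

theorem exists_mul_symVar_root (i : ι) (a : SymR R M) :
    ∃ v, v * symVar R (P.root i) = a - (symRefl P R i : SymR R M →+* SymR R M) a := by
  simp only [RingHom.coe_coe]
  induction a using SymR.induction with
  | h1 r => exact ⟨0, by simp⟩
  | h2 l => exact ⟨_, symRefl_symVar_sub P i l⟩
  | hmul a c ha hc =>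
    obtain ⟨u, hu⟩ := ha
    obtain ⟨v, hv⟩ := hc
    exact ⟨u * c + symRefl P R i a * v, by
      rw [add_mul, mul_right_comm, hu, mul_assoc, hv, map_mul]; ring⟩
  | hadd a c ha hc =>
    obtain ⟨u, hu⟩ := ha
    obtain ⟨v, hv⟩ := hc
    exact ⟨u + v, by rw [add_mul, hu, hv, map_add]; ring⟩

variable [Module.Free ℤ M] [Module.Finite ℤ M] (h2 : ∀ r : R, 2 * r = 0 → r = 0)

include h2

theorem symVar_root_mem_nonZeroDivisors (i : ι) :
    symVar R (P.root i) ∈ nonZeroDivisors (SymR R M) :=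
  symVar_mem_nonZeroDivisors h2 (P.coroot' i) (coroot'_root_self P i)

theorem symDel_add (i : ι) (a c : SymR R M) :
    symDel P R i (a + c) = symDel P R i a + symDel P R i c :=
  divDiff_add (exists_mul_symVar_root P i) (symVar_root_mem_nonZeroDivisors P h2 i) a c

theorem symDel_mul (i : ι) (a c : SymR R M) :
    symDel P R i (a * c) = symDel P R i a * c + symRefl P R i a * symDel P R i c :=
  divDiff_mul (exists_mul_symVar_root P i) (symVar_root_mem_nonZeroDivisors P h2 i) a c

theorem symDel_algebraMap (i : ι) (r : R) : symDel P R i (algebraMap R _ r) = 0 :=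
  divDiff_of_fixed (exists_mul_symVar_root P i) (symVar_root_mem_nonZeroDivisors P h2 i)
    (by simp)

theorem symDel_symVar (i : ι) (l : M) :
    symDel P R i (symVar R l) = P.coroot' i l • (1 : SymR R M) :=
  eq_divDiff (exists_mul_symVar_root P i) (symVar_root_mem_nonZeroDivisors P h2 i)
    (symRefl_symVar_sub P i l)

theorem symDel_symDel (i : ι) (a : SymR R M) : symDel P R i (symDel P R i a) = 0 :=
  divDiff_divDiff (exists_mul_symVar_root P i) (symVar_root_mem_nonZeroDivisors P h2 i)
    (symRefl_symRefl P i) (by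
      rw [RingHom.coe_coe, symRefl_symVar, weylGroup_smul_root, ofIdx_smul_self, root_negIdx,
        symVar_neg]) a

variable (R) in
/-- `symDel` as an additive map. -/
def symDelHom (i : ι) : SymR R M →+ SymR R M := AddMonoidHom.mk' (symDel P R i) (symDel_add P h2 i)

theorem symDel_zero (i : ι) : symDel P R i 0 = 0 := map_zero (symDelHom P R h2 i)

theorem symDel_zsmul (i : ι) (n : ℤ) (a : SymR R M) :
    symDel P R i (n • a) = n • symDel P R i a := map_zsmul (symDelHom P R h2 i) n a

theorem symDel_list_sum (i : ι) (l : List (SymR R M)) :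
    symDel P R i l.sum = (l.map (symDel P R i)).sum := map_list_sum (symDelHom P R h2 i) l

variable {P} (b : P.Base)

omit h2 [Module.Free ℤ M] [Module.Finite ℤ M] in
@[simp] theorem symDelWord_nil (a : SymR R M) : symDelWord b R [] a = a := rfl

omit h2 [Module.Free ℤ M] [Module.Finite ℤ M] in
@[simp] theorem symDelWord_cons (i : b.support) (I : List b.support) (a : SymR R M) :
    symDelWord b R (i :: I) a = symDel P R (i : ι) (symDelWord b R I a) := rfl

theorem symDelWord_add (I : List b.support) (a c : SymR R M) :
    symDelWord b R I (a + c) = symDelWord b R I a + symDelWord b R I c := by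
  induction I with
  | nil => rfl
  | cons i I ih => simp only [symDelWord_cons, ih, symDel_add P h2]

theorem symDelWord_algebraMap_mul (I : List b.support) (r : R) (a : SymR R M) :
    symDelWord b R I (algebraMap R _ r * a) = algebraMap R _ r * symDelWord b R I a := by
  induction I with
  | nil => rfl
  | cons i I ih =>
    simp only [symDelWord_cons, ih, symDel_mul P h2, symDel_algebraMap P h2, AlgHom.commutes,
      zero_mul, zero_add]

theorem symDelWord_algebraMap {I : List b.support} (hI : I ≠ []) (r : R) :
    symDelWord b R I (algebraMap R _ r) = 0 := by
  induction I with
  | nil => exact absurd rfl hI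
  | cons i I ih =>
    rw [symDelWord_cons]
    by_cases h : I = []
    · rw [h, symDelWord_nil, symDel_algebraMap P h2]
    · rw [ih h, symDel_zero P h2]

/-- The commutation rule of a composition of divided differences with the multiplication by an
element of degree one. -/
theorem symDelWord_symVar_mul (I : List b.support) (l : M) (a : SymR R M) :
    symDelWord b R I (symVar R l * a) = symVar R (wordProd b I • l) * symDelWord b R I a +
      ((deletions b I).map fun q => P.coroot' q.1 l • symDelWord b R q.2 a).sum := by
  induction I with
  | nil => simp [deletions]
  | cons i I ih =>
    -- Let `w` be the product of the tail. The deletion of the head comes from `Δ_i` hitting the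
    -- linear form `w l`, with value `⟨w l, α_i^∨⟩ = ⟨l, (w⁻¹ α_i)^∨⟩`; the other deletions come
    -- from `Δ_i` applied to the sum already present.
    rw [symDelWord_cons, ih, symDel_add P h2, symDel_mul P h2, symDel_symVar P h2, symRefl_symVar,
      symDel_list_sum P h2, deletions, List.map_cons, List.sum_cons, coroot'_inv_smul,
      wordProd_cons, mul_smul, smul_one_mul, List.map_map, List.map_map, symDelWord_cons]
    have : (symDel P R (i : ι) ∘ fun q : ι × List b.support =>
          P.coroot' q.1 l • symDelWord b R q.2 a) =
        (fun q : ι × List b.support => P.coroot' q.1 l • symDelWord b R q.2 a) ∘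
          fun q => (q.1, i :: q.2) := by
      funext q
      simp only [Function.comp_apply, symDel_zsmul P h2, symDelWord_cons]
    rw [this]
    abel

variable [Finite ι] [P.IsReduced]

/-- Words of the same length and the same product define the same composition of divided
differences, and a word that is not reduced defines zero. -/
theorem symDelWord_eq_and_eq_zero (n : ℕ) :
    (∀ I J : List b.support, I.length = n → J.length = n → wordProd b I = wordProd b J →
      ∀ a, symDelWord b R I a = symDelWord b R J a) ∧
    (∀ I : List b.support, I.length = n → ¬ IsReduced b I → ∀ a, symDelWord b R I a = 0) := by
  induction n with
  | zero =>
    refine ⟨fun I J hI hJ _ a => ?_, fun I hI h => ?_⟩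
    · rw [List.length_eq_zero_iff.1 hI, List.length_eq_zero_iff.1 hJ]
    · rw [List.length_eq_zero_iff.1 hI] at h
      exact absurd (length_one b).symm h
  | succ n ih =>
    obtain ⟨ih1, ih2⟩ := ih
    have hred : ∀ I : List b.support, I.length = n + 1 → ¬ IsReduced b I →
        ∀ a, symDelWord b R I a = 0 := by
      intro I hI h a
      cases I with
      | nil => simp at hI
      | cons i I =>
        have hI' : I.length = n := by simpa using hI
        rw [symDelWord_cons]
        by_cases hr : IsReduced b I
        -- The reduced tail may be replaced by a word starting with `i`, and `Δ_i Δ_i = 0`.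
        · obtain ⟨K, hK, hK'⟩ := exists_cons_of_not_isReduced b hr h
          rw [ih1 I (i :: K) hI' (hK.trans hI') hK'.symm, symDelWord_cons, symDel_symDel P h2]
        · rw [ih2 I hI' hr, symDel_zero P h2]
    refine ⟨fun I J hI hJ hIJ a => ?_, hred⟩
    by_cases hIr : IsReduced b I
    swap
    · have hJr : ¬ IsReduced b J := by
        rwa [IsReduced, hJ, ← hIJ, ← hI]
      rw [hred I hI hIr, hred J hJ hJr]
    have hJr : IsReduced b J := by
      rwa [IsReduced, hJ, ← hIJ, ← hI]
    classical
    -- By induction, words of length `n` define an operator indexed by the group element; the value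
    -- `0` where there is no such word is never used.
    let E : P.weylGroup → SymR R M → SymR R M := fun v c =>
      if h : ∃ K : List b.support, K.length = n ∧ wordProd b K = v then
        symDelWord b R h.choose c else 0
    have hE : ∀ K : List b.support, K.length = n → ∀ c,
        symDelWord b R K c = E (wordProd b K) c := by
      intro K hK c
      have h : ∃ K' : List b.support, K'.length = n ∧ wordProd b K' = wordProd b K := ⟨K, hK, rfl⟩
      simp only [E, dif_pos h]
      exact ih1 _ _ hK h.choose_spec.1 h.choose_spec.2.symm c
    have hsum : ∀ K : List b.support, K.length = n + 1 → ∀ l c,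
        ((deletions b K).map fun q => P.coroot' q.1 l • symDelWord b R q.2 c).sum =
        ((inversions b K).map fun j => P.coroot' j l •
          E (wordProd b K * weylGroup.ofIdx P j) c).sum := by
      intro K hK l c
      rw [inversions, List.map_map]
      congr 1
      refine List.map_congr_left fun q hq => ?_
      obtain ⟨hq1, hq2⟩ := deletions_spec b hq
      rw [Function.comp_apply, hE q.2 (by omega), hq2]
    -- The correction terms are now a sum over inversions of quantities depending only on the
    -- product, and reduced words of one product have the same inversions.
    have hmul : ∀ l c, symDelWord b R I c = symDelWord b R J c →
        symDelWord b R I (symVar R l * c) = symDelWord b R J (symVar R l * c) := by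
      intro l c h
      rw [symDelWord_symVar_mul h2, symDelWord_symVar_mul h2, h, hsum I hI, hsum J hJ, hIJ,
        ((hIr.inversions_perm hJr hIJ).map _).sum_eq]
    have hmul' : ∀ d c, symDelWord b R I c = symDelWord b R J c →
        symDelWord b R I (d * c) = symDelWord b R J (d * c) := by
      intro d
      induction d using SymR.induction with
      | h1 r => intro c h; rw [symDelWord_algebraMap_mul h2, symDelWord_algebraMap_mul h2, h]
      | h2 l => exact hmul l
      | hmul d e hd he => intro c h; rw [mul_assoc]; exact hd _ (he _ h)
      | hadd d e hd he =>
        intro c h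
        rw [add_mul, symDelWord_add h2, symDelWord_add h2, hd _ h, he _ h]
    -- Agreement passes from `c` to all multiples of `c`, so it is enough to look at `1`, which both
    -- nonempty words kill.
    rw [← mul_one a]
    refine hmul' a 1 ?_
    rw [← map_one (algebraMap R _), symDelWord_algebraMap h2, symDelWord_algebraMap h2]
    · rintro rfl; simp at hJ
    · rintro rfl; simp at hI

end SymDel

/-! ### Linear algebra over the ring of invariants -/

section BasisOfOperators

/-- Operators that are combinations of the elements of a finite group with denominators, and an
invertible matrix of values, give a basis over the ring of invariants. -/
theorem exists_basis_of_isUnit_det {W S : Type*} [Group W] [Fintype W] [DecidableEq W] [CommRing S]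
    (ρ : W → S →+* S) (hone : ∀ u, ρ 1 u = u) (hmul : ∀ g h u, ρ (g * h) u = ρ g (ρ h u))
    (A : Subring S) (hA : ∀ u, u ∈ A ↔ ∀ w, ρ w u = u) (T : W → S → S)
    (hT : ∀ v, ∃ y ∈ nonZeroDivisors S, ∃ a : W → S, ∀ u, y * T v u = ∑ w, a w * ρ w u)
    (c : W → S) (hdet : IsUnit (Matrix.of fun v w => T v (c w)).det) :
    ∃ B : Module.Basis W A S, ∀ w, B w = c w := by
  choose y hy a ha using hT
  let D : Matrix W W S := Matrix.of fun v w => T v (c w)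
  let E : Matrix W W S := Matrix.of fun v w => ρ v (c w)
  let Q : Matrix W W S := Matrix.of a
  have hDE : Matrix.diagonal y * D = Q * E := by
    ext v w
    rw [Matrix.diagonal_mul, Matrix.mul_apply]
    exact ha v (c w)
  have hreg : Q.det * E.det ∈ nonZeroDivisors S := by
    rw [← Matrix.det_mul, ← hDE, Matrix.det_mul, Matrix.det_diagonal]
    exact mul_mem (prod_mem fun v _ => hy v) hdet.mem_nonZeroDivisors
  obtain ⟨hQ, hE⟩ := mul_mem_nonZeroDivisors.1 hreg
  have hinj : ∀ (B : Matrix W W S), B.det ∈ nonZeroDivisors S → ∀ z, B.mulVec z = 0 → z = 0 := by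
    intro B hB z hz
    have h1 := congrArg B.adjugate.mulVec hz
    rw [Matrix.mulVec_mulVec, Matrix.adjugate_mul, Matrix.smul_mulVec, Matrix.one_mulVec,
      Matrix.mulVec_zero] at h1
    funext w
    exact (mul_left_mem_nonZeroDivisors_eq_zero_iff hB).1 (congrFun h1 w)
  -- Applying every `v` to a relation with invariant coefficients gives a vector killed by `E`.
  have hli : LinearIndependent A c := by
    rw [Fintype.linearIndependent_iff]
    intro g hg w
    have h1 : (fun w => (g w : S)) = 0 := by
      refine hinj E hE _ (funext fun v => ?_)
      rw [Pi.zero_apply, ← map_zero (ρ v), ← hg, map_sum]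
      refine Finset.sum_congr rfl fun w _ => ?_
      rw [Subring.smul_def, smul_eq_mul, map_mul, (hA _).1 (g w).2 v, mul_comm]
      rfl
    exact Subtype.ext (congrFun h1 w)
  have hspan : ∀ u, u ∈ Submodule.span A (Set.range c) := by
    intro u
    let z : W → S := D⁻¹.mulVec fun v => T v u
    have hz : D.mulVec z = fun v => T v u := by
      simp only [z]
      rw [Matrix.mulVec_mulVec, Matrix.mul_nonsing_inv D hdet, Matrix.one_mulVec]
    -- From `D z = T(u)` and `diag(y) D = Q E`, the matrix `Q` kills the difference of the two
    -- sides.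
    have h1 : E.mulVec z = fun v => ρ v u := by
      have h2 : (fun v => ρ v u) - E.mulVec z = 0 := by
        refine hinj Q hQ _ ?_
        rw [Matrix.mulVec_sub, Matrix.mulVec_mulVec, ← hDE, ← Matrix.mulVec_mulVec, hz]
        funext v
        rw [Pi.sub_apply, Matrix.mulVec_diagonal, ha]
        exact sub_self _
      exact (sub_eq_zero.1 h2).symm
    have hinv : ∀ w, z w ∈ A := by
      intro w
      rw [hA]
      intro g
      -- Applying `g` to the row `g⁻¹ v` shows that `g z` solves the same system as `z`.
      have h2 : E.mulVec (fun w => ρ g (z w)) = fun v => ρ v u := by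
        funext v
        have h3 := congrArg (ρ g) (congrFun h1 (g⁻¹ * v))
        rw [← hmul, mul_inv_cancel_left] at h3
        rw [← h3]
        simp only [Matrix.mulVec, dotProduct, map_sum, map_mul]
        refine Finset.sum_congr rfl fun w _ => ?_
        congr 1
        simp only [E, Matrix.of_apply]
        rw [← hmul, mul_inv_cancel_left]
      have h4 := hinj E hE ((fun w => ρ g (z w)) - z) (by rw [Matrix.mulVec_sub, h1, h2, sub_self])
      exact congrFun (sub_eq_zero.1 h4) w
    have h5 : u = ∑ w, (⟨z w, hinv w⟩ : A) • c w := by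
      have h6 := congrFun h1 1
      simp only [hone] at h6
      rw [← h6]
      refine Finset.sum_congr rfl fun w _ => ?_
      simp only [E, Matrix.of_apply, Subring.smul_def, smul_eq_mul, hone]
      exact mul_comm _ _
    rw [h5]
    exact Submodule.sum_mem _ fun w _ => Submodule.smul_mem _ _ (Submodule.subset_span ⟨w, rfl⟩)
  exact ⟨Module.Basis.mk hli fun u _ => hspan u, fun w => Module.Basis.mk_apply _ _ w⟩

/-- A matrix that becomes triangular with invertible diagonal after a permutation of its rows is
invertible. -/
theorem isUnit_det_of_triangular {W R : Type*} [Fintype W] [DecidableEq W] [CommRing R] (ℓ : W → ℕ)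
    (E : Matrix W W R) (σ : W ≃ W) (hdiag : ∀ w, IsUnit (E (σ w) w))
    (hzero : ∀ v w, v ≠ w → ℓ w ≤ ℓ v → E (σ v) w = 0) : IsUnit E.det := by
  have h1 : IsUnit (E.submatrix σ id).det := by
    have ht : (E.submatrix σ id).BlockTriangular ℓ := fun v w h =>
      hzero v w (by rintro rfl; exact lt_irrefl _ h) h.le
    rw [ht.det]
    rw [IsUnit.prod_iff]
    intro k _
    -- Inside a block of constant length the vanishing hypothesis still kills everything off the
    -- diagonal.
    have h2 : (E.submatrix σ id).toSquareBlock ℓ k =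
        Matrix.diagonal fun w : {w // ℓ w = k} => E (σ w) w := by
      ext v w
      by_cases h : v = w
      · subst h; simp [Matrix.toSquareBlock_def]
      · rw [Matrix.diagonal_apply_ne _ h]
        exact hzero _ _ (fun h' => h (Subtype.ext h')) (le_of_eq (w.2.trans v.2.symm))
    rw [h2, Matrix.det_diagonal]
    rw [IsUnit.prod_iff]; exact fun w _ => hdiag w
  rw [Matrix.det_permute] at h1
  exact isUnit_of_mul_isUnit_right h1

end BasisOfOperators

/-! ### Topology of the completed polynomial ring -/

section CompletedPoly

variable {R : Type*} [CommRing R] {S : Type*}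

theorem augIdeal_eq_idealOfVars : augIdeal R S = idealOfVars S R := by
  ext p
  rw [← pow_one (idealOfVars S R), mem_pow_idealOfVars_iff', augIdeal, RingHom.mem_ker,
    constantCoeff_eq]
  refine ⟨fun h d hd => ?_, fun h => h 0 (by simp)⟩
  rw [(Finsupp.degree_eq_zero_iff d).1 (by omega), h]

theorem mem_augIdeal_pow_iff {n : ℕ} {p : MvPolynomial S R} :
    p ∈ augIdeal R S ^ n ↔ ∀ d, d.degree < n → p.coeff d = 0 := by
  rw [augIdeal_eq_idealOfVars, mem_pow_idealOfVars_iff']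

theorem sub_homogeneousComponent_mem {n : ℕ} {p : MvPolynomial S R} (hp : p ∈ augIdeal R S ^ n) :
    p - homogeneousComponent n p ∈ augIdeal R S ^ (n + 1) := by
  rw [mem_augIdeal_pow_iff] at hp ⊢
  intro d hd
  rw [coeff_sub, coeff_homogeneousComponent]
  split_ifs with h
  · simp
  · rw [hp d (by omega), sub_zero]

theorem IsHomogeneous.mem_augIdeal_pow {n : ℕ} {p : MvPolynomial S R} (hp : p.IsHomogeneous n) :
    p ∈ augIdeal R S ^ n := by
  rw [mem_augIdeal_pow_iff]
  intro d hd
  exact hp.coeff_eq_zero hd.ne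

/-- The inclusion of the polynomials in the completion. -/
def ofPoly : MvPolynomial S R →+* CompletedPoly R S := algebraMap _ _

theorem evalₐ_ofPoly (n : ℕ) (p : MvPolynomial S R) :
    AdicCompletion.evalₐ (augIdeal R S) n (ofPoly p) = Ideal.Quotient.mk _ p := by
  rw [ofPoly, AlgHom.commutes]; rfl

theorem mem_nhdIdeal {n : ℕ} {z : CompletedPoly R S} :
    z ∈ nhdIdeal R S n ↔ AdicCompletion.evalₐ (augIdeal R S) n z = 0 := Iff.rfl

theorem ofPoly_mem_nhdIdeal {n : ℕ} {p : MvPolynomial S R} :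
    ofPoly p ∈ nhdIdeal R S n ↔ p ∈ augIdeal R S ^ n := by
  rw [mem_nhdIdeal, evalₐ_ofPoly, Ideal.Quotient.eq_zero_iff_mem]

theorem exists_sub_ofPoly_mem (z : CompletedPoly R S) (n : ℕ) :
    ∃ p, z - ofPoly p ∈ nhdIdeal R S n := by
  obtain ⟨p, hp⟩ := Ideal.Quotient.mk_surjective (AdicCompletion.evalₐ (augIdeal R S) n z)
  exact ⟨p, by rw [mem_nhdIdeal, map_sub, evalₐ_ofPoly, hp, sub_self]⟩

theorem nhdIdeal_anti {m n : ℕ} (h : m ≤ n) : nhdIdeal R S n ≤ nhdIdeal R S m := by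
  intro z hz
  obtain ⟨f, rfl⟩ := AdicCompletion.mk_surjective (augIdeal R S) (MvPolynomial S R) z
  rw [mem_nhdIdeal, AdicCompletion.evalₐ_mk, Ideal.Quotient.eq_zero_iff_mem] at hz ⊢
  have h1 := f.property h
  rw [SModEq.sub_mem] at h1
  have h2 : f.val m - f.val n ∈ augIdeal R S ^ m := by simpa using h1
  have := add_mem h2 (Ideal.pow_le_pow_right h hz)
  rwa [sub_add_cancel] at this

/-- Both factors are replaced by polynomial approximations, for which the claim is about powers of
the augmentation ideal. -/
theorem nhdIdeal_mul_mem {m n : ℕ} {y z : CompletedPoly R S} (hy : y ∈ nhdIdeal R S m)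
    (hz : z ∈ nhdIdeal R S n) : y * z ∈ nhdIdeal R S (m + n) := by
  obtain ⟨p, hp⟩ := exists_sub_ofPoly_mem y (m + n)
  obtain ⟨q, hq⟩ := exists_sub_ofPoly_mem z (m + n)
  have hp' : p ∈ augIdeal R S ^ m := by
    rw [← ofPoly_mem_nhdIdeal]
    simpa using sub_mem hy (nhdIdeal_anti (Nat.le_add_right m n) hp)
  have hq' : q ∈ augIdeal R S ^ n := by
    rw [← ofPoly_mem_nhdIdeal]
    simpa using sub_mem hz (nhdIdeal_anti (Nat.le_add_left n m) hq)
  have h1 : ofPoly (p * q) ∈ nhdIdeal R S (m + n) := by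
    rw [ofPoly_mem_nhdIdeal, pow_add]; exact Ideal.mul_mem_mul hp' hq'
  have h2 : y * z = (y - ofPoly p) * z + ofPoly p * (z - ofPoly q) + ofPoly (p * q) := by
    rw [map_mul]; ring
  rw [h2]
  exact add_mem (add_mem (Ideal.mul_mem_right _ _ hp) (Ideal.mul_mem_left _ _ hq)) h1

theorem eq_zero_of_forall_mem_nhdIdeal {z : CompletedPoly R S} (h : ∀ n, z ∈ nhdIdeal R S n) :
    z = 0 := AdicCompletion.ext_evalₐ fun n => by rw [mem_nhdIdeal.1 (h n), map_zero]

theorem nhdIdeal_zero : nhdIdeal R S 0 = ⊤ := by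
  rw [eq_top_iff]
  intro z _
  obtain ⟨p, hp⟩ := exists_sub_ofPoly_mem z 0
  have h : ofPoly p ∈ nhdIdeal R S 0 := by rw [ofPoly_mem_nhdIdeal]; simp
  simpa using add_mem hp h

theorem exists_lim (f : ℕ → CompletedPoly R S) (hf : ∀ n, f (n + 1) - f n ∈ nhdIdeal R S n) :
    ∃ v, ∀ n, v - f n ∈ nhdIdeal R S n := by
  choose p hp using fun n => exists_sub_ofPoly_mem (f n) n
  refine ⟨AdicCompletion.mk (augIdeal R S) (MvPolynomial S R)
    (AdicCompletion.AdicCauchySequence.mk _ _ p fun n => ?_), fun n => ?_⟩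
  · rw [SModEq.comm, SModEq.sub_mem]
    have h1 : ofPoly (p (n + 1) - p n) ∈ nhdIdeal R S n := by
      have : ofPoly (p (n + 1) - p n) =
          (f (n + 1) - f n) - (f (n + 1) - ofPoly (p (n + 1))) + (f n - ofPoly (p n)) := by
        rw [map_sub]; ring
      rw [this]
      exact add_mem (sub_mem (hf n) (nhdIdeal_anti n.le_succ (hp (n + 1)))) (hp n)
    rw [ofPoly_mem_nhdIdeal] at h1
    simpa using h1
  · have h1 := hp n
    rw [mem_nhdIdeal, map_sub, sub_eq_zero, evalₐ_ofPoly] at h1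
    rw [mem_nhdIdeal, map_sub, h1, AdicCompletion.evalₐ_mk]
    exact sub_self _

theorem completedAug_ofPoly (p : MvPolynomial S R) :
    completedAug R S (ofPoly p) = constantCoeff p := by
  rw [completedAug, RingHom.comp_apply, RingHom.coe_coe, evalₐ_ofPoly, Ideal.Quotient.lift_mk]

theorem mem_nhdIdeal_one {z : CompletedPoly R S} :
    z ∈ nhdIdeal R S 1 ↔ completedAug R S z = 0 := by
  constructor
  · intro h
    rw [completedAug, RingHom.comp_apply, RingHom.coe_coe, mem_nhdIdeal.1 h, map_zero]
  · intro h
    obtain ⟨p, hp⟩ := exists_sub_ofPoly_mem z 1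
    have h1 : completedAug R S (z - ofPoly p) = 0 := by
      rw [completedAug, RingHom.comp_apply, RingHom.coe_coe, mem_nhdIdeal.1 hp, map_zero]
    rw [map_sub, h, zero_sub, neg_eq_zero, completedAug_ofPoly] at h1
    have h2 : ofPoly p ∈ nhdIdeal R S 1 := by rw [ofPoly_mem_nhdIdeal, pow_one]; exact h1
    simpa using add_mem hp h2

theorem pow_mem_nhdIdeal {z : CompletedPoly R S} (hz : z ∈ nhdIdeal R S 1) (n : ℕ) :
    z ^ n ∈ nhdIdeal R S n := by
  induction n with
  | zero => rw [nhdIdeal_zero]; trivial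
  | succ n ih => rw [pow_succ]; exact nhdIdeal_mul_mem ih hz

theorem isUnit_one_sub {z : CompletedPoly R S} (hz : z ∈ nhdIdeal R S 1) : IsUnit (1 - z) := by
  -- The inverse is the limit of the geometric series.
  obtain ⟨v, hv⟩ := exists_lim (fun n => ∑ k ∈ Finset.range n, z ^ k) fun n => by
    rw [Finset.sum_range_succ, add_sub_cancel_left]; exact pow_mem_nhdIdeal hz n
  refine IsUnit.of_mul_eq_one v (sub_eq_zero.1 (eq_zero_of_forall_mem_nhdIdeal fun n => ?_))
  have h1 : (1 - z) * v - 1 = (1 - z) * (v - ∑ k ∈ Finset.range n, z ^ k) - z ^ n := by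
    have := mul_neg_geom_sum z n
    linear_combination this
  rw [h1]
  exact sub_mem (Ideal.mul_mem_left _ _ (hv n)) (pow_mem_nhdIdeal hz n)

theorem isUnit_of_isUnit_completedAug {z : CompletedPoly R S}
    (hz : IsUnit (completedAug R S z)) : IsUnit z := by
  obtain ⟨r, hr⟩ := hz.exists_right_inv
  have h1 : 1 - ofPoly (C r) * z ∈ nhdIdeal R S 1 := by
    rw [mem_nhdIdeal_one, map_sub, map_mul, map_one, completedAug_ofPoly, constantCoeff_C,
      mul_comm, hr, sub_self]
  have h2 := isUnit_one_sub h1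
  rw [sub_sub_cancel] at h2
  exact isUnit_of_mul_isUnit_right h2

theorem completedRename_ofPoly {T : Type*} (f : S → T) (p : MvPolynomial S R) :
    completedRename f (ofPoly p) = ofPoly (rename f p) := by
  refine AdicCompletion.ext_evalₐ fun n => ?_
  rw [evalₐ_completedRename, evalₐ_ofPoly, evalₐ_ofPoly, quotRename, Ideal.quotientMap_mk]
  rfl

/-- A continuous endomorphism is determined by its values at the polynomials. -/
theorem eq_of_forall_ofPoly {T : Type*} {f g : CompletedPoly R S →+* CompletedPoly R T}
    (hf : ∀ n z, z ∈ nhdIdeal R S n → f z ∈ nhdIdeal R T n)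
    (hg : ∀ n z, z ∈ nhdIdeal R S n → g z ∈ nhdIdeal R T n)
    (h : ∀ p, f (ofPoly p) = g (ofPoly p)) : f = g := by
  refine RingHom.ext fun z => ?_
  refine sub_eq_zero.1 (eq_zero_of_forall_mem_nhdIdeal fun n => ?_)
  obtain ⟨p, hp⟩ := exists_sub_ofPoly_mem z n
  have h1 : f z - g z = f (z - ofPoly p) - g (z - ofPoly p) := by
    rw [map_sub, map_sub, h]; ring
  rw [h1]
  exact sub_mem (hf n _ hp) (hg n _ hp)

theorem completedRename_mem_nhdIdeal {T : Type*} (f : S → T) {n : ℕ} {z : CompletedPoly R S}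
    (hz : z ∈ nhdIdeal R S n) : completedRename f z ∈ nhdIdeal R T n := by
  rw [mem_nhdIdeal, evalₐ_completedRename, mem_nhdIdeal.1 hz, map_zero]

theorem completedRename_comp {T U : Type*} (f : S → T) (g : T → U) :
    (completedRename g).comp (completedRename f) =
      (completedRename (g ∘ f) : CompletedPoly R S →+* CompletedPoly R U) := by
  refine eq_of_forall_ofPoly (fun n z hz => ?_) (fun n z => completedRename_mem_nhdIdeal _) fun p => ?_
  · rw [RingHom.comp_apply]
    exact completedRename_mem_nhdIdeal g (completedRename_mem_nhdIdeal f hz)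
  · rw [RingHom.comp_apply, completedRename_ofPoly, completedRename_ofPoly, completedRename_ofPoly,
      rename_rename]

theorem completedRename_id :
    (completedRename id : CompletedPoly R S →+* CompletedPoly R S) = RingHom.id _ := by
  refine eq_of_forall_ofPoly (fun n z => completedRename_mem_nhdIdeal _) (fun n z hz => ?_)
    fun p => ?_
  · rwa [RingHom.id_apply]
  · rw [completedRename_ofPoly, rename_id_apply, RingHom.id_apply]

theorem completedAug_completedRename {T : Type*} (f : S → T) (z : CompletedPoly R S) :
    completedAug R T (completedRename f z) = completedAug R S z := by
  obtain ⟨p, hp⟩ := exists_sub_ofPoly_mem z 1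
  have h1 := mem_nhdIdeal_one.1 hp
  have h2 := mem_nhdIdeal_one.1 (completedRename_mem_nhdIdeal f hp)
  rw [map_sub, sub_eq_zero] at h1
  rw [map_sub, map_sub, sub_eq_zero, completedRename_ofPoly, completedAug_ofPoly,
    constantCoeff_rename] at h2
  rw [h1, h2, completedAug_ofPoly]

end CompletedPoly

/-! ### The shape `F(X, Y) = X + Y - X Y g(X, Y)` -/

section FormalGroupLaw

open Finsupp

variable {R : Type*} [CommRing R] (F : FormalGroup R)

theorem coeff_Xzero (i : ℕ) : F.Xzero.coeff i = F.toPowerSeries.coeff (single 0 i) := by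
  rw [PowerSeries.coeff, MvPowerSeries.coeff_subst, finsum_eq_single _ (single 0 i)]
  · simp [PowerSeries.coeff_X_pow]
  · intro d hd
    by_cases hd₁ : d 1 = 0
    · have : d = single 0 (d 0) := by ext j; fin_cases j <;> simp [hd₁]
      have h : i ≠ d 0 := by rintro rfl; exact hd this
      simp [hd₁, PowerSeries.coeff_X_pow, h]
    simp [hd₁]
  · exact MvPowerSeries.HasSubst.X_zero

theorem coeff_zeroX (i : ℕ) : F.zeroX.coeff i = F.toPowerSeries.coeff (single 1 i) := by
  rw [PowerSeries.coeff, MvPowerSeries.coeff_subst, finsum_eq_single _ (single 1 i)]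
  · simp [PowerSeries.coeff_X_pow]
  · intro d hd
    by_cases hd₁ : d 0 = 0
    · have : d = single 1 (d 1) := by ext j; fin_cases j <;> simp [hd₁]
      have h : i ≠ d 1 := by rintro rfl; exact hd this
      simp [hd₁, PowerSeries.coeff_X_pow, h]
    simp [hd₁]
  · exact MvPowerSeries.HasSubst.zero_X

theorem coeff_single_zero (i : ℕ) :
    F.toPowerSeries.coeff (single 0 i) = if i = 1 then 1 else 0 := by
  rw [← coeff_Xzero, F.Xzero_eq_X, PowerSeries.coeff_X]

theorem coeff_single_one (i : ℕ) :
    F.toPowerSeries.coeff (single 1 i) = if i = 1 then 1 else 0 := by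
  rw [← coeff_zeroX, F.zeroX_eq_X, PowerSeries.coeff_X]

theorem coeff_gSeries (i j : ℕ) : MvPowerSeries.coeff (single 0 i + single 1 j) (gSeries F) =
    -F.toPowerSeries.coeff (single 0 (i + 1) + single 1 (j + 1)) := by
  change -MvPowerSeries.coeff (single 0 i + single 1 j + single 0 1 + single 1 1) F.toPowerSeries = _
  rw [single_add, single_add]
  congr 3
  abel

variable {S : Type*}

/-- The unit axioms remove all pure powers except the linear terms, and the part of `F` of degree `d
+ 2` is `-X Y` times the part of `g` of degree `d`; hence the shift by two. -/
theorem partialSum_add_two (s t : S) (n : ℕ) : partialSum F.toPowerSeries s t (n + 2) =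
    X s + X t - X s * X t * partialSum (gSeries F) s t n := by
  unfold partialSum
  rw [Finset.sum_range_succ', Finset.sum_range_succ', Finset.mul_sum]
  have h0 : F.toPowerSeries.coeff 0 = 0 := by
    rw [MvPowerSeries.coeff_zero_eq_constantCoeff_apply, F.zero_constantCoeff]
  have h1 : ∑ ij ∈ Finset.HasAntidiagonal.antidiagonal (0 + 1),
      C (MvPowerSeries.coeff (single 0 ij.1 + single 1 ij.2) F.toPowerSeries) *
        (X s ^ ij.1 * X t ^ ij.2) = (X s + X t : MvPolynomial S R) := by
    rw [Finset.Nat.sum_antidiagonal_succ]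
    simp [F.lin_coeff_X, F.lin_coeff_Y, add_comm]
  have h2 : ∀ d, ∑ ij ∈ Finset.HasAntidiagonal.antidiagonal (d + 1 + 1),
      C (MvPowerSeries.coeff (single 0 ij.1 + single 1 ij.2) F.toPowerSeries) *
        (X s ^ ij.1 * X t ^ ij.2) = -(X s * X t * ∑ ij ∈ Finset.HasAntidiagonal.antidiagonal d,
      C (MvPowerSeries.coeff (single 0 ij.1 + single 1 ij.2) (gSeries F)) *
        (X s ^ ij.1 * X t ^ ij.2) : MvPolynomial S R) := by
    intro d
    rw [Finset.Nat.sum_antidiagonal_succ, Finset.Nat.sum_antidiagonal_succ']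
    simp only [single_zero, zero_add, add_zero, coeff_single_zero, coeff_single_one]
    simp only [show ¬ d + 1 + 1 = 1 by omega, if_false]
    rw [C_0, zero_mul, zero_mul, zero_add, zero_add, Finset.mul_sum, ← Finset.sum_neg_distrib]
    refine Finset.sum_congr rfl fun ij _ => ?_
    rw [coeff_gSeries, C_neg, pow_succ, pow_succ]
    ring
  rw [h1, Finset.sum_congr rfl fun d _ => h2 d]
  simp [h0]
  ring

theorem specialize_eq (s t : S) : specialize F.toPowerSeries s t =
    var s + var t - var s * var t * specialize (gSeries F) s t := by
  refine AdicCompletion.ext_evalₐ fun n => ?_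
  have h : partialSum F.toPowerSeries s t (n + 2) - partialSum F.toPowerSeries s t n ∈
      augIdeal R S ^ n := by
    have h1 := partialSum_succ_sub_mem F.toPowerSeries s t n
    have h2 := Ideal.pow_le_pow_right n.le_succ (partialSum_succ_sub_mem F.toPowerSeries s t (n + 1))
    simpa using add_mem h2 h1
  rw [map_sub, map_add, map_mul, map_mul, evalₐ_specialize, evalₐ_specialize, evalₐ_var, evalₐ_var,
    ← map_mul, ← map_mul, ← map_add, ← map_sub, ← partialSum_add_two]
  exact ((Ideal.Quotient.mk_eq_mk_iff_sub_mem _ _).2 h).symm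

end FormalGroupLaw

/-! ### The formal group ring and its filtrations -/

section FGR

variable {R : Type*} [CommRing R] (F : FormalGroup R) (M : Type*) [AddCommGroup M]

/-- The projection `R⟦x_M⟧ → R⟦M⟧_F`. -/
def proj : CompletedPoly R M →+* FGR F M := Ideal.Quotient.mk _

theorem proj_surjective : Function.Surjective (proj F M) := Ideal.Quotient.mk_surjective

/-- The image in `R⟦M⟧_F` of the neighbourhood `nhdIdeal n` of `0`. -/
def nhd (n : ℕ) : Ideal (FGR F M) := (nhdIdeal R M n).map (proj F M)

variable {M}

theorem mem_nhd {n : ℕ} {u : FGR F M} : u ∈ nhd F M n ↔ ∃ z ∈ nhdIdeal R M n, proj F M z = u :=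
  Ideal.mem_map_iff_of_surjective _ (proj_surjective F M)

theorem proj_mem_nhd {n : ℕ} {z : CompletedPoly R M} (hz : z ∈ nhdIdeal R M n) :
    proj F M z ∈ nhd F M n := (mem_nhd F).2 ⟨z, hz, rfl⟩

theorem nhd_anti {m n : ℕ} (h : m ≤ n) : nhd F M n ≤ nhd F M m := Ideal.map_mono (nhdIdeal_anti h)

theorem proj_eq_zero_of_forall {z : CompletedPoly R M}
    (h : ∀ n, z ∈ relIdeal F M ⊔ nhdIdeal R M n) : proj F M z = 0 :=
  Ideal.Quotient.eq_zero_iff_mem.2 ((Submodule.mem_iInf _).2 h)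

theorem proj_eq_zero_of_mem_relIdeal {z : CompletedPoly R M} (h : z ∈ relIdeal F M) :
    proj F M z = 0 := proj_eq_zero_of_forall F fun _ => Ideal.mem_sup_left h

/-- The quotient is separated because the ideal divided out is closed. -/
theorem eq_zero_of_forall_mem_nhd {u : FGR F M} (h : ∀ n, u ∈ nhd F M n) : u = 0 := by
  obtain ⟨z, rfl⟩ := proj_surjective F M u
  refine proj_eq_zero_of_forall F fun n => ?_
  obtain ⟨y, hy, hyz⟩ := (mem_nhd F).1 (h n)
  have h1 : z - y ∈ closureIdeal R (relIdeal F M) := by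
    rw [← Ideal.Quotient.eq_zero_iff_mem, map_sub, sub_eq_zero]
    exact hyz.symm
  have h2 := (Submodule.mem_iInf _).1 h1 n
  simpa using add_mem h2 (Ideal.mem_sup_right hy)

theorem proj_var (l : M) : proj F M (var l) = x F l := rfl

theorem proj_ofPoly_C (r : R) : proj F M (ofPoly (C r)) = algebraMap R (FGR F M) r := rfl

theorem proj_ofPoly (p : MvPolynomial M R) : proj F M (ofPoly p) = aeval (x F) p := by
  have : (proj F M).comp ofPoly = (aeval (x F) : MvPolynomial M R →ₐ[R] FGR F M) := by
    refine MvPolynomial.ringHom_ext (fun r => ?_) fun l => ?_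
    · rw [RingHom.comp_apply, proj_ofPoly_C]; simp
    · rw [RingHom.comp_apply]; simp only [RingHom.coe_coe, aeval_X]; rfl
  exact congrArg (fun f => f p) this

/-- The element `g(x_l, x_m)`. -/
def gElt (l m : M) : FGR F M := proj F M (specialize (gSeries F) l m)

theorem x_add (l m : M) : x F (l + m) = x F l + x F m - x F l * x F m * gElt F l m := by
  have h : proj F M (var (l + m) - specialize F.toPowerSeries l m) = 0 :=
    proj_eq_zero_of_mem_relIdeal F (Ideal.subset_span (Or.inr ⟨l, m, rfl⟩))
  rw [map_sub, sub_eq_zero, specialize_eq, map_sub, map_add, map_mul, map_mul] at h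
  exact h

theorem aug_proj (z : CompletedPoly R M) : aug F M (proj F M z) = completedAug R M z :=
  Ideal.Quotient.lift_mk _ _ _

theorem aug_algebraMap (r : R) : aug F M (algebraMap R _ r) = r := by
  rw [← proj_ofPoly_C, aug_proj, completedAug_ofPoly, constantCoeff_C]

theorem mem_IF {u : FGR F M} : u ∈ IF F M ↔ aug F M u = 0 := Iff.rfl

theorem x_mem_IF (l : M) : x F l ∈ IF F M := by
  have h : (var l : CompletedPoly R M) = ofPoly (X l) := rfl
  rw [mem_IF, ← proj_var, aug_proj, h, completedAug_ofPoly, constantCoeff_X]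

theorem isUnit_of_isUnit_aug {u : FGR F M} (h : IsUnit (aug F M u)) : IsUnit u := by
  obtain ⟨z, rfl⟩ := proj_surjective F M u
  rw [aug_proj] at h
  exact (isUnit_of_isUnit_completedAug h).map (proj F M)

theorem nhd_mul_mem {m n : ℕ} {u v : FGR F M} (hu : u ∈ nhd F M m) (hv : v ∈ nhd F M n) :
    u * v ∈ nhd F M (m + n) := by
  obtain ⟨y, hy, rfl⟩ := (mem_nhd F).1 hu
  obtain ⟨z, hz, rfl⟩ := (mem_nhd F).1 hv
  rw [← map_mul]
  exact proj_mem_nhd F (nhdIdeal_mul_mem hy hz)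

theorem IF_eq_nhd_one : IF F M = nhd F M 1 := by
  ext u
  constructor
  · intro h
    obtain ⟨z, rfl⟩ := proj_surjective F M u
    rw [mem_IF, aug_proj] at h
    exact proj_mem_nhd F (mem_nhdIdeal_one.2 h)
  · intro h
    obtain ⟨z, hz, rfl⟩ := (mem_nhd F).1 h
    rw [mem_IF, aug_proj]
    exact mem_nhdIdeal_one.1 hz

theorem nhd_zero : nhd F M 0 = ⊤ := by
  rw [nhd, nhdIdeal_zero, Ideal.map_top]

/-- One inclusion suffices: the operators are controlled by the powers of `I_F`, while limits and
separatedness are available for `nhd`. -/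
theorem IF_pow_le_nhd (n : ℕ) : IF F M ^ n ≤ nhd F M n := by
  induction n with
  | zero => rw [nhd_zero]; exact le_top
  | succ n ih =>
    rw [pow_succ, Ideal.mul_le]
    intro u hu v hv
    rw [IF_eq_nhd_one] at hv
    exact nhd_mul_mem F (ih hu) hv

theorem aeval_x_mem_IF_pow {n : ℕ} {p : MvPolynomial M R} (hp : p ∈ augIdeal R M ^ n) :
    aeval (x F) p ∈ IF F M ^ n := by
  have h : augIdeal R M ≤ (IF F M).comap (aeval (x F) : MvPolynomial M R →ₐ[R] FGR F M) := by
    intro q hq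
    rw [Ideal.mem_comap, mem_IF, ← proj_ofPoly, aug_proj, completedAug_ofPoly]
    exact hq
  exact (Ideal.pow_right_mono h n).trans (Ideal.le_comap_pow _ n) hp

/-- An element of `nhd n` is congruent modulo `nhd (n + 1)` to a homogeneous polynomial of degree
`n` in the `x_l`. -/
theorem exists_isHomogeneous_sub_mem {n : ℕ} {u : FGR F M} (hu : u ∈ nhd F M n) :
    ∃ p : MvPolynomial M R, p.IsHomogeneous n ∧ u - aeval (x F) p ∈ nhd F M (n + 1) := by
  obtain ⟨z, hz, rfl⟩ := (mem_nhd F).1 hu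
  obtain ⟨p, hp⟩ := exists_sub_ofPoly_mem z (n + 1)
  have h1 : p ∈ augIdeal R M ^ n := by
    rw [← ofPoly_mem_nhdIdeal]
    simpa using sub_mem hz (nhdIdeal_anti n.le_succ hp)
  refine ⟨homogeneousComponent n p, homogeneousComponent_isHomogeneous n p, ?_⟩
  rw [← proj_ofPoly, ← map_sub]
  refine proj_mem_nhd F ?_
  have h2 := add_mem hp (ofPoly_mem_nhdIdeal.2 (sub_homogeneousComponent_mem h1))
  rw [map_sub] at h2
  simpa using h2

section Functoriality

variable {M' M'' : Type*} [AddCommGroup M'] [AddCommGroup M'']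

theorem hat_proj (f : M →+ M') (z : CompletedPoly R M) :
    hat F f (proj F M z) = proj F M' (completedRename f z) := Ideal.quotientMap_mk

theorem hat_x (f : M →+ M') (l : M) : hat F f (x F l) = x F (f l) := by
  rw [← proj_var, hat_proj, completedRename_var, proj_var]

theorem hat_algebraMap (f : M →+ M') (r : R) :
    hat F f (algebraMap R _ r) = algebraMap R _ r := by
  rw [← proj_ofPoly_C, hat_proj, completedRename_ofPoly, rename_C, proj_ofPoly_C]

theorem hat_hat (f : M →+ M') (g : M' →+ M'') (u : FGR F M) :
    hat F g (hat F f u) = hat F (g.comp f) u := by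
  obtain ⟨z, rfl⟩ := proj_surjective F M u
  rw [hat_proj, hat_proj, hat_proj]
  exact congrArg (fun h => proj F M'' (h z)) (completedRename_comp (R := R) f g)

theorem hat_eq_self {f : M →+ M} (hf : ∀ l, f l = l) (u : FGR F M) : hat F f u = u := by
  obtain ⟨z, rfl⟩ := proj_surjective F M u
  have : (f : M → M) = id := funext hf
  rw [hat_proj, this, completedRename_id, RingHom.id_apply]

theorem aug_hat (f : M →+ M') (u : FGR F M) : aug F M' (hat F f u) = aug F M u := by
  obtain ⟨z, rfl⟩ := proj_surjective F M u
  rw [hat_proj, aug_proj, aug_proj, completedAug_completedRename]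

theorem hat_mem_nhd (f : M →+ M') {n : ℕ} {u : FGR F M} (hu : u ∈ nhd F M n) :
    hat F f u ∈ nhd F M' n := by
  obtain ⟨z, hz, rfl⟩ := (mem_nhd F).1 hu
  rw [hat_proj]
  exact proj_mem_nhd F (completedRename_mem_nhdIdeal f hz)

theorem hat_mem_IF_pow (f : M →+ M') {n : ℕ} {u : FGR F M} (hu : u ∈ IF F M ^ n) :
    hat F f u ∈ IF F M' ^ n := by
  have h : IF F M ≤ (IF F M').comap (hat F f) := fun v hv => by
    rw [Ideal.mem_comap, mem_IF, aug_hat]; exact hv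
  exact (Ideal.pow_right_mono h n).trans (Ideal.le_comap_pow _ n) hu

end Functoriality

end FGR

/-! ### Divisibility of `u - s_α(u)` by `x_α` -/

section Divisibility

variable {R : Type*} [CommRing R] (F : FormalGroup R) {M : Type*} [AddCommGroup M]

/-- The quotient modulo `I_F` is recorded because it becomes the pairing with the coroot, the
leading term of `Δ_α(x_λ)`. -/
theorem exists_x_add_nsmul (l m : M) (n : ℕ) :
    ∃ c ∈ IF F M, x F (l + n • m) = x F l + x F m * (n + c) := by
  induction n with
  | zero => exact ⟨0, zero_mem _, by simp⟩
  | succ n ih =>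
    obtain ⟨c, hc, h⟩ := ih
    refine ⟨c - x F (l + n • m) * gElt F (l + n • m) m,
      sub_mem hc (Ideal.mul_mem_right _ _ (x_mem_IF F _)), ?_⟩
    have h1 := x_add F (l + n • m) m
    rw [add_assoc, ← succ_nsmul] at h1
    rw [h1]
    push_cast
    linear_combination h

theorem exists_x_add_zsmul (l m : M) (n : ℤ) :
    ∃ c ∈ IF F M, x F (l + n • m) = x F l + x F m * (n + c) := by
  obtain ⟨n, rfl | rfl⟩ := n.eq_nat_or_neg
  · simpa using exists_x_add_nsmul F l m n
  · obtain ⟨c, hc, h⟩ := exists_x_add_nsmul F (l + (-(n : ℤ)) • m) m n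
    refine ⟨-c, neg_mem hc, ?_⟩
    have h1 : l + (-(n : ℤ)) • m + n • m = l := by
      rw [neg_smul, natCast_zsmul, neg_add_cancel_right]
    rw [h1] at h
    push_cast
    linear_combination -h

variable {ι N : Type*} [AddCommGroup N] (P : RootDatum ι M N)

theorem refl_x (i : ι) (l : M) : refl P F i (x F l) = x F (weylGroup.ofIdx P i • l) :=
  hat_x F _ l

theorem exists_mul_x_root_x (i : ι) (l : M) :
    ∃ c ∈ IF F M, (P.coroot' i l + c) * x F (P.root i) = x F l - refl P F i (x F l) := by
  obtain ⟨c, hc, h⟩ := exists_x_add_zsmul F l (P.root i) (-P.coroot' i l)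
  refine ⟨-c, neg_mem hc, ?_⟩
  rw [refl_x, ofIdx_smul_eq_sub, sub_eq_add_neg l, ← neg_smul, h]
  push_cast
  ring

theorem exists_mul_x_root_aeval (i : ι) (p : MvPolynomial M R) :
    ∃ v, v * x F (P.root i) = aeval (x F) p - refl P F i (aeval (x F) p) := by
  induction p using MvPolynomial.induction_on with
  | C r =>
    refine ⟨0, ?_⟩
    rw [algHom_C, refl, hat_algebraMap, zero_mul, sub_self]
  | add p q h1 h2 =>
    obtain ⟨u, hu⟩ := h1
    obtain ⟨v, hv⟩ := h2
    exact ⟨u + v, by rw [add_mul, hu, hv, map_add, map_add]; ring⟩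
  | mul_X p l h1 =>
    obtain ⟨u, hu⟩ := h1
    obtain ⟨c, -, hc⟩ := exists_mul_x_root_x F P i l
    refine ⟨u * x F l + refl P F i (aeval (x F) p) * (P.coroot' i l + c), ?_⟩
    rw [add_mul, mul_right_comm, hu, mul_assoc, hc, map_mul, map_mul, aeval_X]
    ring

/-- The bound on the quotient makes the limit in `exists_mul_x_root` converge. For `k = 0` truncated
subtraction makes it vacuous. -/
theorem exists_mul_x_root_aeval_mem (i : ι) (k : ℕ) (p : MvPolynomial M R)
    (hp : p ∈ augIdeal R M ^ k) :
    ∃ v ∈ IF F M ^ (k - 1), v * x F (P.root i) = aeval (x F) p - refl P F i (aeval (x F) p) := by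
  induction k generalizing p with
  | zero =>
    simp only [Nat.zero_sub, pow_zero, Ideal.one_eq_top, Submodule.mem_top, true_and]
    exact exists_mul_x_root_aeval F P i p
  | succ k ih =>
    rw [pow_succ] at hp
    induction hp using Submodule.mul_induction_on' with
    | mem_mul_mem p hp q hq =>
      obtain ⟨u, hu, hu'⟩ := ih p hp
      obtain ⟨v, hv'⟩ := exists_mul_x_root_aeval F P i q
      refine ⟨u * aeval (x F) q + refl P F i (aeval (x F) p) * v, add_mem ?_ ?_, ?_⟩
      · rw [Nat.add_sub_cancel]
        have hq1 : aeval (x F) q ∈ IF F M ^ 1 := aeval_x_mem_IF_pow F (by rwa [pow_one])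
        have := Ideal.mul_mem_mul hu hq1
        rw [← pow_add] at this
        exact Ideal.pow_le_pow_right (by omega) this
      · exact Ideal.mul_mem_right _ _ (hat_mem_IF_pow F _ (aeval_x_mem_IF_pow F hp))
      · rw [add_mul, mul_right_comm, hu', mul_assoc, hv', map_mul, map_mul]
        ring
    | add p hp q hq h1 h2 =>
      obtain ⟨u, hu, hu'⟩ := h1
      obtain ⟨v, hv, hv'⟩ := h2
      exact ⟨u + v, add_mem hu hv, by rw [add_mul, hu', hv', map_add, map_add]; ring⟩

/-- The difference `u - s_α(u)` is divisible by `x_α`. -/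
theorem exists_mul_x_root (i : ι) (u : FGR F M) :
    ∃ v, v * x F (P.root i) = u - refl P F i u := by
  obtain ⟨z, rfl⟩ := proj_surjective F M u
  choose p hp using exists_sub_ofPoly_mem z
  have hd : ∀ n, p (n + 1) - p n ∈ augIdeal R M ^ n := by
    intro n
    rw [← ofPoly_mem_nhdIdeal, map_sub]
    simpa using sub_mem (hp n) (nhdIdeal_anti n.le_succ (hp (n + 1)))
  -- The quotients of consecutive differences of approximations are summed; they are lifted to the
  -- completion, where limits exist.
  choose v hv hv' using fun n => exists_mul_x_root_aeval_mem F P i n _ (hd n)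
  obtain ⟨v₀, hv₀⟩ := exists_mul_x_root_aeval F P i (p 0)
  choose q hq hq' using fun n => (mem_nhd F).1 (IF_pow_le_nhd F _ (hv n))
  -- The term `q k` has order `k - 1`, so the range `n + 1` is what the Cauchy condition needs.
  obtain ⟨y, hy⟩ := exists_lim (fun n => ∑ k ∈ Finset.range (n + 1), q k) fun n => by
    rw [Finset.sum_range_succ _ (n + 1), add_sub_cancel_left]; exact hq (n + 1)
  have hsum : ∀ n, (v₀ + proj F M (∑ k ∈ Finset.range n, q k)) * x F (P.root i) =
      aeval (x F) (p n) - refl P F i (aeval (x F) (p n)) := by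
    intro n
    induction n with
    | zero => simpa using hv₀
    | succ n ih =>
      rw [Finset.sum_range_succ, map_add, ← add_assoc, add_mul, ih, hq', hv', map_sub, map_sub]
      ring
  refine ⟨v₀ + proj F M y, sub_eq_zero.1 (eq_zero_of_forall_mem_nhd F fun n => ?_)⟩
  have h1 := proj_mem_nhd F (hy n)
  have h2 := proj_mem_nhd F (nhdIdeal_anti n.le_succ (hp (n + 1)))
  have h3 : refl P F i (proj F M (z - ofPoly (p (n + 1)))) ∈ nhd F M n := hat_mem_nhd F _ h2
  rw [map_sub, proj_ofPoly] at h2 h3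
  rw [map_sub] at h1 h3
  have h4 := hsum (n + 1)
  have h5 : (v₀ + proj F M y) * x F (P.root i) - (proj F M z - refl P F i (proj F M z)) =
      (proj F M y - proj F M (∑ k ∈ Finset.range (n + 1), q k)) * x F (P.root i)
      - (proj F M z - aeval (x F) (p (n + 1)))
      + (refl P F i (proj F M z) - refl P F i (aeval (x F) (p (n + 1)))) := by
    linear_combination h4
  rw [h5]
  exact add_mem (sub_mem (Ideal.mul_mem_right _ _ h1) h2) h3

end Divisibility

/-! ### Power series as points of the formal group -/

section OrderIdeal

variable {R : Type*} [CommRing R] {σ : Type*}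

variable (R σ) in
/-- The ideal of the power series without terms of degree `< n`. -/
def orderIdeal (n : ℕ) : Ideal (MvPowerSeries σ R) where
  carrier := {f | (n : ℕ∞) ≤ f.order}
  add_mem' hf hg := (le_min hf hg).trans (MvPowerSeries.min_order_le_add)
  zero_mem' := by simp
  smul_mem' f g hg := by
    rw [smul_eq_mul]
    change (n : ℕ∞) ≤ _ at hg ⊢
    exact (le_add_left hg).trans MvPowerSeries.le_order_mul

theorem mem_orderIdeal {n : ℕ} {f : MvPowerSeries σ R} :
    f ∈ orderIdeal R σ n ↔ (n : ℕ∞) ≤ f.order := Iff.rfl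

theorem mem_orderIdeal_iff {n : ℕ} {f : MvPowerSeries σ R} :
    f ∈ orderIdeal R σ n ↔ ∀ d : σ →₀ ℕ, d.degree < n → MvPowerSeries.coeff d f = 0 := by
  refine ⟨fun h d hd => MvPowerSeries.coeff_of_lt_order (lt_of_lt_of_le (by exact_mod_cast hd) h),
    fun h => MvPowerSeries.le_order fun d hd => h d (by exact_mod_cast hd)⟩

theorem mem_orderIdeal_one {f : MvPowerSeries σ R} :
    f ∈ orderIdeal R σ 1 ↔ MvPowerSeries.constantCoeff f = 0 := by
  rw [mem_orderIdeal_iff, ← MvPowerSeries.coeff_zero_eq_constantCoeff_apply]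
  refine ⟨fun h => h 0 (by simp), fun h d hd => ?_⟩
  rw [(Finsupp.degree_eq_zero_iff d).1 (by omega), h]

theorem mul_mem_orderIdeal {m n : ℕ} {f g : MvPowerSeries σ R} (hf : f ∈ orderIdeal R σ m)
    (hg : g ∈ orderIdeal R σ n) : f * g ∈ orderIdeal R σ (m + n) := by
  rw [mem_orderIdeal] at *
  push_cast
  exact (add_le_add hf hg).trans MvPowerSeries.le_order_mul

theorem orderIdeal_anti {m n : ℕ} (h : m ≤ n) : orderIdeal R σ n ≤ orderIdeal R σ m :=
  fun _ hf => le_trans (Nat.cast_le.2 h : (m : ℕ∞) ≤ n) (mem_orderIdeal.1 hf)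

theorem orderIdeal_zero : orderIdeal R σ 0 = ⊤ :=
  (Ideal.eq_top_iff_one _).2 (by rw [mem_orderIdeal]; simp)

theorem eq_zero_of_forall_mem_orderIdeal {f : MvPowerSeries σ R}
    (h : ∀ n, f ∈ orderIdeal R σ n) : f = 0 := by
  ext d
  exact mem_orderIdeal_iff.1 (h (d.degree + 1)) d (Nat.lt_succ_self _)

theorem orderIdeal_pow_le (n : ℕ) : orderIdeal R σ 1 ^ n ≤ orderIdeal R σ n := by
  induction n with
  | zero => intro f _; rw [mem_orderIdeal]; simp
  | succ n ih =>
    rw [pow_succ, Ideal.mul_le]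
    exact fun f hf g hg => mul_mem_orderIdeal (ih hf) hg

theorem coeff_partialSum (G : MvPowerSeries (Fin 2) R) {n : ℕ} {d : Fin 2 →₀ ℕ}
    (hd : d.degree < n) :
    coeff d (partialSum G (0 : Fin 2) 1 n) = MvPowerSeries.coeff d G := by
  have hX : ∀ i j : ℕ, (X 0 ^ i * X 1 ^ j : MvPolynomial (Fin 2) R) =
      monomial (Finsupp.single 0 i + Finsupp.single 1 j) 1 := by
    intro i j
    rw [X_pow_eq_monomial, X_pow_eq_monomial, monomial_mul, one_mul]
  have hd' : Finsupp.single 0 (d 0) + Finsupp.single 1 (d 1) = d := by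
    ext i; fin_cases i <;> simp
  have hdeg : d.degree = d 0 + d 1 := by
    rw [Finsupp.degree_eq_sum]; simp
  have hmem : (d 0, d 1) ∈ Finset.HasAntidiagonal.antidiagonal d.degree := by
    rw [Finset.HasAntidiagonal.mem_antidiagonal, hdeg]
  unfold partialSum
  simp only [coeff_sum, coeff_C_mul, hX, coeff_monomial]
  rw [Finset.sum_eq_single_of_mem d.degree (Finset.mem_range.2 hd),
    Finset.sum_eq_single_of_mem _ hmem]
  · simp only
    rw [hd', if_pos rfl, mul_one]
  · intro ij _ hij
    rw [if_neg, mul_zero]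
    rintro h
    apply hij
    rw [← h]
    simp
  · intro k _ hk
    refine Finset.sum_eq_zero fun ij hij => ?_
    rw [if_neg, mul_zero]
    rintro h
    rw [Finset.HasAntidiagonal.mem_antidiagonal] at hij
    apply hk
    rw [← h, ← hij]
    simp

theorem hasSubst_of_mem {f : MvPowerSeries σ R} (hf : f ∈ orderIdeal R σ 1) :
    PowerSeries.HasSubst f := by
  rw [PowerSeries.HasSubst, mem_orderIdeal_one.1 hf]
  exact IsNilpotent.zero

theorem hasSubst_pair {f g : MvPowerSeries σ R} (hf : f ∈ orderIdeal R σ 1)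
    (hg : g ∈ orderIdeal R σ 1) : MvPowerSeries.HasSubst ![f, g] := by
  rw [mem_orderIdeal_one] at hf hg
  refine MvPowerSeries.hasSubst_of_constantCoeff_nilpotent fun s => ?_
  fin_cases s <;> simp [hf, hg]

theorem aeval_partialSum {S : Type*} (y : S → MvPowerSeries σ R) (G : MvPowerSeries (Fin 2) R)
    (s t : S) (n : ℕ) :
    aeval y (partialSum G s t n) = aeval ![y s, y t] (partialSum G (0 : Fin 2) 1 n) := by
  simp [partialSum]

/-- The substitution in a power series in two variables is approximated by its partial sums. -/
theorem subst_sub_aeval_partialSum_mem {f g : MvPowerSeries σ R} (hf : f ∈ orderIdeal R σ 1)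
    (hg : g ∈ orderIdeal R σ 1) (G : MvPowerSeries (Fin 2) R) (n : ℕ) :
    MvPowerSeries.subst ![f, g] G - aeval ![f, g] (partialSum G (0 : Fin 2) 1 n) ∈
      orderIdeal R σ n := by
  have hs := hasSubst_pair hf hg
  rw [← MvPowerSeries.subst_coe (a := ![f, g]) (partialSum G (0 : Fin 2) 1 n),
    ← MvPowerSeries.subst_sub hs, mem_orderIdeal]
  refine le_trans ?_ (MvPowerSeries.le_order_subst hs _)
  have h1 : (1 : ℕ∞) ≤ ⨅ i, (![f, g] i).order := by
    refine le_iInf fun i => ?_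
    fin_cases i
    · exact_mod_cast hf
    · exact_mod_cast hg
  have h2 : (n : ℕ∞) ≤ (G - (partialSum G (0 : Fin 2) 1 n : MvPowerSeries (Fin 2) R)).order := by
    rw [← mem_orderIdeal, mem_orderIdeal_iff]
    intro d hd
    rw [map_sub, MvPolynomial.coeff_coe, coeff_partialSum G hd, sub_self]
  simpa using mul_le_mul' h1 h2

theorem aeval_sub_aeval_mem {A : Type*} [CommRing A] [Algebra R A] {τ : Type*} (J : Ideal A)
    {y z : τ → A} (h : ∀ i, y i - z i ∈ J) (p : MvPolynomial τ R) :
    aeval y p - aeval z p ∈ J := by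
  induction p using MvPolynomial.induction_on with
  | C r => simp
  | add p q hp hq =>
    rw [map_add, map_add, add_sub_add_comm]
    exact add_mem hp hq
  | mul_X p i hp =>
    have : aeval y (p * X i) - aeval z (p * X i) =
        aeval y p * (y i - z i) + z i * (aeval y p - aeval z p) := by
      simp only [map_mul, aeval_X]; ring
    rw [this]
    exact add_mem (J.mul_mem_left _ (h i)) (J.mul_mem_left _ hp)

/-- The group law of a formal group, evaluated at series without constant term, is approximately
additive. -/
theorem subst_add_sub_mem (F : FormalGroup R) {f g c : MvPowerSeries σ R} {n : ℕ}
    (hn : 1 ≤ n) (hf : f ∈ orderIdeal R σ 1) (hg : g ∈ orderIdeal R σ 1)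
    (hc : c ∈ orderIdeal R σ n) :
    MvPowerSeries.subst ![f, g + c] F.toPowerSeries -
      (MvPowerSeries.subst ![f, g] F.toPowerSeries + c) ∈ orderIdeal R σ (n + 1) := by
  have hgc : g + c ∈ orderIdeal R σ 1 := add_mem hg (orderIdeal_anti hn hc)
  have h1 := orderIdeal_anti (show n + 1 ≤ n + 1 + 1 by omega)
    (subst_sub_aeval_partialSum_mem hf hgc F.toPowerSeries (n + 2))
  have h2 := orderIdeal_anti (show n + 1 ≤ n + 1 + 1 by omega)
    (subst_sub_aeval_partialSum_mem hf hg F.toPowerSeries (n + 2))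
  -- With `G`, `G'` the values of `g` at the two points, the error is `-c f G' - f g (G' - G)`, and
  -- `G' - G` has order at least `n`.
  have h3 : aeval ![f, g + c] (partialSum (gSeries F) (0 : Fin 2) 1 n) -
      aeval ![f, g] (partialSum (gSeries F) (0 : Fin 2) 1 n) ∈ orderIdeal R σ n := by
    refine aeval_sub_aeval_mem _ (fun i => ?_) _
    fin_cases i <;> simp [hc]
  rw [partialSum_add_two] at h1 h2
  simp only [map_sub, map_add, map_mul, aeval_X, Matrix.cons_val_zero, Matrix.cons_val_one,
    Matrix.cons_val_fin_one] at h1 h2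
  have h4 := mul_mem_orderIdeal hc hf
  have h5 := mul_mem_orderIdeal h3 (Ideal.mul_mem_right g _ hf)
  have := sub_mem (sub_mem (sub_mem h1 h2) (Ideal.mul_mem_right
    (aeval ![f, g + c] (partialSum (gSeries F) (0 : Fin 2) 1 n)) _ h4)) h5
  convert this using 1
  ring

/-- Inverses for the group law of a formal group. -/
theorem exists_subst_eq_zero (F : FormalGroup R) {f : MvPowerSeries σ R}
    (hf : f ∈ orderIdeal R σ 1) :
    ∃ g ∈ orderIdeal R σ 1, MvPowerSeries.subst ![f, g] F.toPowerSeries = 0 := by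
  -- Successive approximation: subtracting the error `F(f, y_k)` raises its order by at least one.
  let y : ℕ → MvPowerSeries σ R := fun k =>
    k.rec 0 fun _ g => g + -MvPowerSeries.subst ![f, g] F.toPowerSeries
  have hy : ∀ k, y (k + 1) = y k + -MvPowerSeries.subst ![f, y k] F.toPowerSeries := fun k => rfl
  have key : ∀ k, y k ∈ orderIdeal R σ 1 ∧
      MvPowerSeries.subst ![f, y k] F.toPowerSeries ∈ orderIdeal R σ (k + 1) := by
    intro k
    induction k with
    | zero =>
      refine ⟨zero_mem _, ?_⟩
      change MvPowerSeries.subst ![f, 0] F.toPowerSeries ∈ _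
      rw [F.add_zero (hasSubst_of_mem hf)]
      exact hf
    | succ k ih =>
      have h1 := neg_mem ih.2
      have h2 := subst_add_sub_mem F (Nat.succ_le_succ (Nat.zero_le k)) hf ih.1 h1
      rw [← hy, add_neg_cancel, sub_zero] at h2
      refine ⟨?_, h2⟩
      rw [hy]
      exact add_mem ih.1 (orderIdeal_anti (by omega) h1)
  have hcoeff : ∀ k d, d.degree < k → ∀ j, k ≤ j →
      MvPowerSeries.coeff d (y j) = MvPowerSeries.coeff d (y k) := by
    intro k d hd j hj
    induction j, hj using Nat.le_induction with
    | base => rfl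
    | succ j hj ih =>
      rw [hy, map_add, ih, map_neg, mem_orderIdeal_iff.1 (key j).2 d (by omega), neg_zero, add_zero]
  -- The coefficients of degree `d` are stable from `y (d + 1)` on.
  let g : MvPowerSeries σ R := fun d => MvPowerSeries.coeff d (y (d.degree + 1))
  have hg : ∀ k, g - y k ∈ orderIdeal R σ k := by
    intro k
    rw [mem_orderIdeal_iff]
    intro d hd
    rw [map_sub, sub_eq_zero]
    exact (hcoeff (d.degree + 1) d (Nat.lt_succ_self _) k (by omega)).symm
  have hg1 : g ∈ orderIdeal R σ 1 := by
    have := add_mem (hg 1) (key 1).1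
    rwa [sub_add_cancel] at this
  refine ⟨g, hg1, eq_zero_of_forall_mem_orderIdeal fun n => ?_⟩
  have h := subst_add_sub_mem F (Nat.succ_le_succ (Nat.zero_le n)) hf (key (n + 1)).1 (hg (n + 1))
  rw [add_sub_cancel] at h
  have h2 := add_mem (orderIdeal_anti (show n ≤ n + 1 + 1 by omega) h)
    (add_mem (orderIdeal_anti (show n ≤ n + 1 + 1 by omega) (key (n + 1)).2)
      (orderIdeal_anti (show n ≤ n + 1 by omega) (hg (n + 1))))
  rwa [sub_add_cancel] at h2

section Points

variable (F : FormalGroup R) (σ)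

theorem subst_mem_orderIdeal {f g : MvPowerSeries σ R} (hf : f ∈ orderIdeal R σ 1)
    (hg : g ∈ orderIdeal R σ 1) :
    MvPowerSeries.subst ![f, g] F.toPowerSeries ∈ orderIdeal R σ 1 := by
  have h := subst_sub_aeval_partialSum_mem hf hg F.toPowerSeries 2
  rw [partialSum_add_two] at h
  have h2 := add_mem (orderIdeal_anti one_le_two h) (add_mem hf hg)
  simpa [partialSum] using h2

/-- The power series without constant term, as a group for the group law given by `F`. -/
def FormalPoints (_ : FormalGroup R) : Type _ := {f : MvPowerSeries σ R // f ∈ orderIdeal R σ 1}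

instance : Zero (FormalPoints σ F) := ⟨⟨0, zero_mem _⟩⟩

instance : Add (FormalPoints σ F) :=
  ⟨fun f g => ⟨MvPowerSeries.subst ![f.1, g.1] F.toPowerSeries, subst_mem_orderIdeal σ F f.2 g.2⟩⟩

instance : Neg (FormalPoints σ F) :=
  ⟨fun f => ⟨(exists_subst_eq_zero F f.2).choose, (exists_subst_eq_zero F f.2).choose_spec.1⟩⟩

instance [F.IsComm] : AddCommGroup (FormalPoints σ F) where
  add_assoc f g h := Subtype.ext
    (F.assoc' (hasSubst_of_mem f.2) (hasSubst_of_mem g.2) (hasSubst_of_mem h.2))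
  zero_add f := Subtype.ext (F.zero_add (hasSubst_of_mem f.2))
  add_zero f := Subtype.ext (F.add_zero (hasSubst_of_mem f.2))
  nsmul := nsmulRec
  zsmul := zsmulRec
  neg_add_cancel f := Subtype.ext <|
    (F.comm' (hasSubst_of_mem (exists_subst_eq_zero F f.2).choose_spec.1)
      (hasSubst_of_mem f.2)).trans (exists_subst_eq_zero F f.2).choose_spec.2
  add_comm f g := Subtype.ext (F.comm' (hasSubst_of_mem f.2) (hasSubst_of_mem g.2))

variable {σ F}

theorem FormalPoints.val_add (f g : FormalPoints σ F) :
    (f + g).1 = MvPowerSeries.subst ![f.1, g.1] F.toPowerSeries := rfl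

theorem FormalPoints.val_zero : (0 : FormalPoints σ F).1 = 0 := rfl

theorem FormalPoints.val_add_sub_mem (f g : FormalPoints σ F) :
    (f + g).1 - (f.1 + g.1) ∈ orderIdeal R σ 2 := by
  have h := subst_sub_aeval_partialSum_mem f.2 g.2 F.toPowerSeries 2
  rw [partialSum_add_two] at h
  simpa [partialSum, FormalPoints.val_add] using h

theorem aeval_points_mem_orderIdeal_of_mem_augIdeal_pow {M : Type*} (f : M → FormalPoints σ F) {k : ℕ}
    {p : MvPolynomial M R} (hp : p ∈ augIdeal R M ^ k) :
    aeval (fun l => (f l).1) p ∈ orderIdeal R σ k := by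
  refine orderIdeal_pow_le k ?_
  have h : augIdeal R M ≤ (orderIdeal R σ 1).comap
      (aeval (fun l => (f l).1) : MvPolynomial M R →ₐ[R] MvPowerSeries σ R) := by
    rw [augIdeal_eq_idealOfVars, idealOfVars, Ideal.span_le]
    rintro _ ⟨l, rfl⟩
    rw [SetLike.mem_coe, Ideal.mem_comap, aeval_X]
    exact (f l).2
  exact (Ideal.pow_right_mono h k).trans (Ideal.le_comap_pow _ k) hp

variable [F.IsComm] {M : Type*} [AddCommGroup M]

/-- A homomorphism from `M` to the points of `F` evaluates polynomials in the `x_λ` compatibly with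
the filtrations. -/
theorem aeval_points_mem_orderIdeal (f : M →+ FormalPoints σ F) {k : ℕ} {p : MvPolynomial M R}
    (hp : aeval (x F) p ∈ nhd F M k) : aeval (fun l => (f l).1) p ∈ orderIdeal R σ k := by
  -- Modulo order `k` evaluation factors through truncated polynomials, so no convergence question
  -- arises.
  let θ : (MvPolynomial M R ⧸ augIdeal R M ^ k) →+* MvPowerSeries σ R ⧸ orderIdeal R σ k :=
    Ideal.Quotient.lift _ ((Ideal.Quotient.mk (orderIdeal R σ k)).comp
      (aeval (fun l => (f l).1) : MvPolynomial M R →ₐ[R] MvPowerSeries σ R).toRingHom)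
      fun q hq => Ideal.Quotient.eq_zero_iff_mem.2
        (aeval_points_mem_orderIdeal_of_mem_augIdeal_pow f hq)
  let Φ : CompletedPoly R M →+* MvPowerSeries σ R ⧸ orderIdeal R σ k :=
    θ.comp (AdicCompletion.evalₐ (augIdeal R M) k : CompletedPoly R M →+* _)
  have hΦ : ∀ q : MvPolynomial M R, θ (Ideal.Quotient.mk _ q) =
      Ideal.Quotient.mk _ (aeval (fun l => (f l).1) q) := fun q => rfl
  have hn : nhdIdeal R M k ≤ RingHom.ker Φ := by
    intro z hz
    rw [nhdIdeal, RingHom.mem_ker] at hz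
    rw [RingHom.mem_ker, RingHom.comp_apply]
    erw [hz]
    exact map_zero _
  have hr : relIdeal F M ≤ RingHom.ker Φ := by
    rw [relIdeal, Ideal.span_le]
    rintro z (rfl | ⟨l, m, rfl⟩)
    · rw [SetLike.mem_coe, RingHom.mem_ker, RingHom.comp_apply, RingHom.coe_coe, evalₐ_var, hΦ,
        aeval_X, map_zero, FormalPoints.val_zero, map_zero]
    · rw [SetLike.mem_coe, RingHom.mem_ker, map_sub, RingHom.comp_apply, RingHom.comp_apply,
        RingHom.coe_coe, evalₐ_var, evalₐ_specialize, hΦ, hΦ, ← map_sub,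
        Ideal.Quotient.eq_zero_iff_mem, aeval_X, map_add, FormalPoints.val_add, aeval_partialSum]
      exact subst_sub_aeval_partialSum_mem (f l).2 (f m).2 _ _
  rw [← proj_ofPoly] at hp
  obtain ⟨z, hz, hzp⟩ := (mem_nhd F).1 hp
  have h1 : ofPoly p - z ∈ closureIdeal R (relIdeal F M) := by
    refine Ideal.Quotient.eq_zero_iff_mem.1 ?_
    change proj F M (ofPoly p - z) = 0
    rw [map_sub, hzp, sub_self]
  have h2 : ofPoly p - z ∈ RingHom.ker Φ := (sup_le hr hn) ((Submodule.mem_iInf _).1 h1 k)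
  have h3 := add_mem h2 (hn hz)
  rw [sub_add_cancel, RingHom.mem_ker, RingHom.comp_apply, RingHom.coe_coe, evalₐ_ofPoly, hΦ] at h3
  exact Ideal.Quotient.eq_zero_iff_mem.1 h3

end Points

end OrderIdeal

/-! ### Leading terms and nearby points -/

section Filtration

variable {R : Type*} [CommRing R] {A : Type*} [CommRing A] [Algebra R A]

/-- Polynomials of high order have nearly the same value at nearby points. -/
theorem aeval_sub_aeval_mem_of_mem_augIdeal_pow {τ : Type*} (J : ℕ → Ideal A)
    (hJ0 : J 0 = ⊤) (hJ : ∀ m n, ∀ a ∈ J m, ∀ b ∈ J n, a * b ∈ J (m + n))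
    {y z : τ → A} (hy : ∀ i, y i ∈ J 1) (hz : ∀ i, z i ∈ J 1) (hyz : ∀ i, y i - z i ∈ J 2)
    {n : ℕ} {p : MvPolynomial τ R} (hp : p ∈ augIdeal R τ ^ n) :
    aeval y p ∈ J n ∧ aeval y p - aeval z p ∈ J (n + 1) := by
  induction n generalizing p with
  | zero =>
    refine ⟨hJ0 ▸ Submodule.mem_top, ?_⟩
    exact aeval_sub_aeval_mem _ (fun i => sub_mem (hy i) (hz i)) p
  | succ n ih =>
    rw [pow_succ, augIdeal_eq_idealOfVars] at hp
    refine Submodule.mul_induction_on hp (fun q hq r hr => ?_) fun q r hq hr => ?_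
    · rw [← augIdeal_eq_idealOfVars] at hq
      rw [idealOfVars] at hr
      induction hr using Submodule.span_induction generalizing q with
      | mem r hr =>
        obtain ⟨i, rfl⟩ := hr
        rw [map_mul, map_mul, aeval_X, aeval_X]
        refine ⟨hJ _ _ _ (ih hq).1 _ (hy i), ?_⟩
        have : aeval y q * y i - aeval z q * z i =
            aeval y q * (y i - z i) + (aeval y q - aeval z q) * z i := by ring
        rw [this]
        exact add_mem (hJ n 2 _ (ih hq).1 _ (hyz i)) (hJ (n + 1) 1 _ (ih hq).2 _ (hz i))
      | zero => simp
      | add r s _ _ hr hs =>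
        rw [mul_add, map_add, map_add, add_sub_add_comm]
        exact ⟨add_mem (hr q hq).1 (hs q hq).1, add_mem (hr q hq).2 (hs q hq).2⟩
      | smul t r _ hr =>
        rw [smul_eq_mul, ← mul_assoc]
        exact hr _ (Ideal.mul_mem_right t _ hq)
    · rw [map_add, map_add, add_sub_add_comm]
      exact ⟨add_mem hq.1 hr.1, add_mem hq.2 hr.2⟩

end Filtration

/-! ### Regularity of `x_α` -/

section Linear

variable {R : Type*} [CommRing R] (F : FormalGroup R) {M : Type*} [AddCommGroup M]
  {σ : Type*} [Fintype σ] (e : Module.Basis σ ℤ M)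

theorem linForm_add (l m : M) : linForm R e (l + m) = linForm R e l + linForm R e m := by
  simp [linForm, add_mul, Finset.sum_add_distrib]

theorem linForm_basis (i : σ) : linForm R e (e i) = X i := by
  classical
  simp [linForm, Finsupp.single_apply, apply_ite, ite_mul]

theorem linForm_isHomogeneous (m : M) : (linForm R e m).IsHomogeneous 1 := by
  refine IsHomogeneous.sum _ _ _ fun i _ => ?_
  have := (isHomogeneous_C σ ((e.repr m i : ℤ) : R)).mul (isHomogeneous_X R i)
  rwa [zero_add] at this

/-- A map that is additive modulo `J` is determined modulo `J` by its values on a basis. -/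
theorem sub_aeval_linForm_mem {A : Type*} [CommRing A] [Algebra R A] (J : Ideal A) (y : M → A)
    (hy : ∀ l m, y (l + m) - (y l + y m) ∈ J) (l : M) :
    y l - aeval (fun i => y (e i)) (linForm R e l) ∈ J := by
  let f : M →+ A ⧸ J := AddMonoidHom.mk' (fun l => Ideal.Quotient.mk J (y l)) fun l m => by
    rw [← map_add, Ideal.Quotient.mk_eq_mk_iff_sub_mem]; exact hy l m
  let g : M →+ A ⧸ J := AddMonoidHom.mk'
    (fun l => Ideal.Quotient.mk J (aeval (fun i => y (e i)) (linForm R e l))) fun l m => by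
    rw [linForm_add, map_add, map_add]
  have h : f.toIntLinearMap = g.toIntLinearMap := e.ext fun i => by
    change Ideal.Quotient.mk J (y (e i)) =
      Ideal.Quotient.mk J (aeval (fun i => y (e i)) (linForm R e (e i)))
    rw [linForm_basis, aeval_X]
  rw [← Ideal.Quotient.mk_eq_mk_iff_sub_mem]
  exact LinearMap.congr_fun h l

theorem x_mem_nhd_one (l : M) : x F l ∈ nhd F M 1 := by
  rw [← IF_eq_nhd_one]; exact x_mem_IF F l

theorem x_add_sub_mem (l m : M) : x F (l + m) - (x F l + x F m) ∈ IF F M ^ 2 := by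
  have h : x F (l + m) - (x F l + x F m) = -gElt F l m * (x F l * x F m) := by
    rw [x_add]; ring
  rw [h, pow_two]
  exact Ideal.mul_mem_left _ _ (Ideal.mul_mem_mul (x_mem_IF F l) (x_mem_IF F m))

/-- Each `x_λ` is regular in `R⟦M⟧_F` if `λ` pairs to `2` with some linear form and `R` has no
`2`-torsion. -/
theorem x_mem_nonZeroDivisors [F.IsComm] {σ : Type*} [Fintype σ] (e : Module.Basis σ ℤ M)
    (h2 : ∀ r : R, 2 * r = 0 → r = 0) (f : M →ₗ[ℤ] ℤ)
    {m : M} (hf : f m = 2) : x F m ∈ nonZeroDivisors (FGR F M) := by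
  rw [mem_nonZeroDivisors_iff_right]
  intro u hu
  let coeAlg : MvPolynomial σ R →ₐ[R] MvPowerSeries σ R :=
    AlgHom.mk coeToMvPowerSeries.ringHom fun r => MvPolynomial.coe_C r
  let v : σ → FormalPoints σ F := fun i =>
    ⟨MvPowerSeries.X i, mem_orderIdeal_one.2 (MvPowerSeries.constantCoeff_X i)⟩
  -- The homomorphism of groups sending `e_i` to the point `X_i`; the leading term of the point of
  -- `λ` is the linear form of `λ`.
  let pt : M →+ FormalPoints σ F := (e.constr ℤ v).toAddMonoidHom
  have hpt : ∀ i, (pt (e i)).1 = MvPowerSeries.X i := fun i =>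
    congrArg (fun f : FormalPoints σ F => f.1) (e.constr_basis ℤ v i)
  have hlin : ∀ l, (pt l).1 - (linForm R e l : MvPowerSeries σ R) ∈ orderIdeal R σ 2 := by
    intro l
    have h := sub_aeval_linForm_mem (R := R) e (orderIdeal R σ 2) (fun l => (pt l).1)
      (fun l m => by rw [map_add]; exact FormalPoints.val_add_sub_mem _ _) l
    simp only [hpt] at h
    have h3 : aeval (fun i => (MvPowerSeries.X i : MvPowerSeries σ R)) (linForm R e l) =
        (linForm R e l : MvPowerSeries σ R) := by
      conv_rhs => rw [← aeval_X_left_apply (linForm R e l)]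
      rw [show (fun i => (MvPowerSeries.X i : MvPowerSeries σ R)) = fun i => coeAlg (X i) from
        funext fun i => (MvPolynomial.coe_X i).symm]
      exact (comp_aeval_apply (X : σ → MvPolynomial σ R) coeAlg (linForm R e l)).symm
    rwa [h3] at h
  suffices h : ∀ n, u ∈ nhd F M n from eq_zero_of_forall_mem_nhd F h
  intro n
  induction n with
  | zero => rw [nhd_zero]; exact Submodule.mem_top
  | succ n ih =>
    -- If `u x_m = 0`, the leading form `p` of `u` should vanish after the `x_λ` are replaced by
    -- their linear forms; then `u` lies one step deeper.
    obtain ⟨p, hp, hup⟩ := exists_isHomogeneous_sub_mem F ih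
    have h1 : aeval (x F) (p * X m) ∈ nhd F M (n + 2) := by
      have := neg_mem (nhd_mul_mem F hup (x_mem_nhd_one F m))
      rw [sub_mul, hu, zero_sub, neg_neg] at this
      rwa [map_mul, aeval_X]
    have hpm : (p * X m).IsHomogeneous (n + 1) := hp.mul (isHomogeneous_X R m)
    have h3 := (aeval_sub_aeval_mem_of_mem_augIdeal_pow (orderIdeal R σ)
      (orderIdeal_zero) (fun _ _ _ ha _ hb => mul_mem_orderIdeal ha hb) (fun l => (pt l).2)
      (fun l => by
        have := sub_mem (pt l).2 (orderIdeal_anti one_le_two (hlin l))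
        rwa [sub_sub_cancel] at this) hlin (IsHomogeneous.mem_augIdeal_pow hpm)).2
    have h4 := sub_mem (aeval_points_mem_orderIdeal pt h1) h3
    rw [sub_sub_cancel] at h4
    have h5 : aeval (fun l => (linForm R e l : MvPowerSeries σ R)) (p * X m) =
        ((aeval (linForm R e) p * linForm R e m : MvPolynomial σ R) : MvPowerSeries σ R) := by
      rw [map_mul, aeval_X, MvPolynomial.coe_mul]
      congr 1
      exact (comp_aeval_apply (linForm R e) coeAlg p).symm
    have h6 : (aeval (linForm R e) p).IsHomogeneous n := by
      simpa using hp.aeval (linForm R e) fun l => linForm_isHomogeneous e l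
    -- The product is homogeneous of degree `n + 1`, but its order as a power series is at least `n
    -- + 2`.
    have h7 : aeval (linForm R e) p * linForm R e m = 0 := by
      ext d
      by_cases hd : d.degree < n + 2
      · rw [← MvPolynomial.coeff_coe, ← h5, mem_orderIdeal_iff.1 h4 d hd, coeff_zero]
      · exact (h6.mul (linForm_isHomogeneous e m)).coeff_eq_zero (by omega)
    have h8 := (mem_nonZeroDivisors_iff_right.1 (linForm_mem_nonZeroDivisors e h2 f hf)) _ h7
    -- Back in the formal group ring, each `x_λ` agrees with its linear form in the `x_{e_i}` modulo
    -- `nhd 2`, so the value of `p` agrees with `0` modulo `nhd (n + 1)`.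
    have h9 := (aeval_sub_aeval_mem_of_mem_augIdeal_pow (nhd F M) (nhd_zero F)
      (fun _ _ _ ha _ hb => nhd_mul_mem F ha hb) (x_mem_nhd_one F)
      (z := fun l => aeval (fun i => x F (e i)) (linForm R e l))
      (fun l => by
        have := sub_mem (x_mem_nhd_one F l) (nhd_anti F one_le_two (IF_pow_le_nhd F 2
          (sub_aeval_linForm_mem (R := R) e _ (x F) (x_add_sub_mem F) l)))
        rwa [sub_sub_cancel] at this)
      (fun l => IF_pow_le_nhd F 2
          (sub_aeval_linForm_mem (R := R) e _ (x F) (x_add_sub_mem F) l))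
      (IsHomogeneous.mem_augIdeal_pow hp)).2
    have h10 : aeval (fun l => aeval (fun i => x F (e i)) (linForm R e l)) p = 0 := by
      rw [← comp_aeval_apply, h8, map_zero]
    rw [h10, sub_zero] at h9
    have := add_mem hup h9
    rwa [sub_add_cancel] at this

end Linear

/-! ### Leading terms of `Δ_α` -/

section DelGraded

variable {ι M N : Type*} [AddCommGroup M] [AddCommGroup N] (P : RootDatum ι M N)
variable {R : Type*} [CommRing R] (F : FormalGroup R) [F.IsComm]
variable [Module.Free ℤ M] [Module.Finite ℤ M] (h2 : ∀ r : R, 2 * r = 0 → r = 0)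

include h2

theorem x_root_mem_nonZeroDivisors (i : ι) : x F (P.root i) ∈ nonZeroDivisors (FGR F M) :=
  x_mem_nonZeroDivisors F (Module.Free.chooseBasis ℤ M) h2 (P.coroot' i) (coroot'_root_self P i)

theorem del_add (i : ι) (u v : FGR F M) : Del P F i (u + v) = Del P F i u + Del P F i v :=
  divDiff_add (exists_mul_x_root F P i) (x_root_mem_nonZeroDivisors P F h2 i) u v

theorem del_mul (i : ι) (u v : FGR F M) :
    Del P F i (u * v) = Del P F i u * v + refl P F i u * Del P F i v :=
  divDiff_mul (exists_mul_x_root F P i) (x_root_mem_nonZeroDivisors P F h2 i) u v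

theorem del_algebraMap (i : ι) (r : R) : Del P F i (algebraMap R _ r) = 0 :=
  divDiff_of_fixed (exists_mul_x_root F P i) (x_root_mem_nonZeroDivisors P F h2 i)
    (hat_algebraMap F _ r)

theorem exists_del_x_eq (i : ι) (l : M) :
    ∃ c ∈ IF F M, Del P F i (x F l) = P.coroot' i l + c := by
  obtain ⟨c, hc, h⟩ := exists_mul_x_root_x F P i l
  exact ⟨c, hc, eq_divDiff (exists_mul_x_root F P i) (x_root_mem_nonZeroDivisors P F h2 i) h⟩

theorem del_mem_IF_pow (i : ι) {n : ℕ} {u : FGR F M} (hu : u ∈ IF F M ^ (n + 1)) :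
    Del P F i u ∈ IF F M ^ n := by
  induction n generalizing u with
  | zero => simp
  | succ n ih =>
    rw [pow_succ] at hu
    refine Submodule.mul_induction_on hu (fun a ha c hc => ?_) fun a c ha hc => ?_
    · rw [del_mul P F h2]
      refine add_mem ?_ (Ideal.mul_mem_right _ _ (hat_mem_IF_pow F _ ha))
      rw [pow_succ]
      exact Ideal.mul_mem_mul (ih ha) hc
    · rw [del_add P F h2]
      exact add_mem ha hc

/-- The operators `Δ_α` on `R⟦M⟧_F` and on `S_R^*(M)` agree to leading order on the values of a
homogeneous polynomial. -/
theorem exists_del_aeval_sub_mem (i : ι) {n : ℕ} {p : MvPolynomial M R} (hp : p.IsHomogeneous n) :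
    ∃ q : MvPolynomial M R, q.IsHomogeneous (n - 1) ∧ (∀ l, (X l * q).IsHomogeneous n) ∧
      aeval (symVar R) q = symDel P R i (aeval (symVar R) p) ∧
      Del P F i (aeval (x F) p) - aeval (x F) q ∈ IF F M ^ n := by
  -- The clause on `X l * q` carries the induction: at `n = 0`, where `n - 1` truncates to `0`,
  -- homogeneity of `q` alone would put the product in degree one.
  have hadd : ∀ {n : ℕ} {p p' : MvPolynomial M R},
      (∃ q : MvPolynomial M R, q.IsHomogeneous (n - 1) ∧ (∀ l, (X l * q).IsHomogeneous n) ∧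
      aeval (symVar R) q = symDel P R i (aeval (symVar R) p) ∧
      Del P F i (aeval (x F) p) - aeval (x F) q ∈ IF F M ^ n) →
      (∃ q : MvPolynomial M R, q.IsHomogeneous (n - 1) ∧ (∀ l, (X l * q).IsHomogeneous n) ∧
      aeval (symVar R) q = symDel P R i (aeval (symVar R) p') ∧
      Del P F i (aeval (x F) p') - aeval (x F) q ∈ IF F M ^ n) →
      (∃ q : MvPolynomial M R, q.IsHomogeneous (n - 1) ∧ (∀ l, (X l * q).IsHomogeneous n) ∧
      aeval (symVar R) q = symDel P R i (aeval (symVar R) (p + p')) ∧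
      Del P F i (aeval (x F) (p + p')) - aeval (x F) q ∈ IF F M ^ n) := by
    rintro n p p' ⟨q, h1, h2', h3, h4⟩ ⟨q', h1', h2'', h3', h4'⟩
    refine ⟨q + q', h1.add h1', fun l => ?_, ?_, ?_⟩
    · rw [mul_add]; exact (h2' l).add (h2'' l)
    · rw [map_add, map_add, symDel_add P h2, h3, h3']
    · rw [map_add, map_add, del_add P F h2, add_sub_add_comm]
      exact add_mem h4 h4'
  have hconst : ∀ r : R, ∀ n, ∃ q : MvPolynomial M R,
      q.IsHomogeneous (n - 1) ∧ (∀ l, (X l * q).IsHomogeneous n) ∧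
      aeval (symVar R) q = symDel P R i (aeval (symVar R) (C r : MvPolynomial M R)) ∧
      Del P F i (aeval (x F) (C r : MvPolynomial M R)) - aeval (x F) q ∈ IF F M ^ n := by
    intro r n
    refine ⟨0, isHomogeneous_zero _ _ _, fun l => ?_, ?_, ?_⟩
    · rw [mul_zero]; exact isHomogeneous_zero _ _ _
    · rw [map_zero, aeval_C, symDel_algebraMap P h2]
    · rw [map_zero, aeval_C, del_algebraMap P F h2, sub_zero]
      exact zero_mem _
  rw [← mem_homogeneousSubmodule, ← homogeneousSubmodule_one_pow] at hp
  induction n generalizing p with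
  | zero =>
    rw [homogeneousSubmodule_one_pow, mem_homogeneousSubmodule,
      ← totalDegree_zero_iff_isHomogeneous, totalDegree_eq_zero_iff_eq_C] at hp
    rw [hp]
    exact hconst _ 0
  | succ n ih =>
    rw [pow_succ] at hp
    refine Submodule.mul_induction_on hp (fun t ht r hr => ?_) fun t r ht hr => hadd ht hr
    rw [homogeneousSubmodule_one_eq_span_X] at hr
    induction hr using Submodule.span_induction generalizing t with
    | mem r hr =>
      obtain ⟨l, rfl⟩ := hr
      obtain ⟨q, -, hq, hqs, hqx⟩ := ih ht
      rw [homogeneousSubmodule_one_pow, mem_homogeneousSubmodule] at ht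
      obtain ⟨c, hc, hcl⟩ := exists_del_x_eq P F h2 i l
      have hhom : (C ((P.coroot' i l : ℤ) : R) * t +
          X (weylGroup.ofIdx P i • l) * q).IsHomogeneous n := (ht.C_mul _).add (hq _)
      refine ⟨C ((P.coroot' i l : ℤ) : R) * t + X (weylGroup.ofIdx P i • l) * q, hhom,
        fun m => ?_, ?_, ?_⟩
      · rw [add_comm n]; exact (isHomogeneous_X R m).mul hhom
      · rw [map_add, map_mul, map_mul, aeval_C, aeval_X, hqs, mul_comm t, map_mul, aeval_X,
          symDel_mul P h2, symDel_symVar P h2, symRefl_symVar]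
        simp
      · have : Del P F i (aeval (x F) (t * X l)) -
            aeval (x F) (C ((P.coroot' i l : ℤ) : R) * t + X (weylGroup.ofIdx P i • l) * q) =
            aeval (x F) t * c + (Del P F i (aeval (x F) t) - aeval (x F) q) *
              x F (weylGroup.ofIdx P i • l) := by
          rw [mul_comm t, map_mul, aeval_X, del_mul P F h2, hcl, refl_x]
          simp only [map_add, map_mul, aeval_X, map_intCast]
          ring
        rw [this, pow_succ]
        exact add_mem (Ideal.mul_mem_mul (aeval_x_mem_IF_pow F
          (IsHomogeneous.mem_augIdeal_pow ht)) hc) (Ideal.mul_mem_mul hqx (x_mem_IF F _))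
    | zero =>
      rw [mul_zero, ← C_0]
      exact hconst 0 _
    | add r s _ _ hr hs =>
      rw [mul_add]
      exact hadd (hr t ht) (hs t ht)
    | smul a r _ hr =>
      rw [mul_smul_comm, ← smul_mul_assoc]
      exact hr _ (Submodule.smul_mem _ _ ht)

end DelGraded

/-! ### Symbols of words of operators -/

section Symbol

variable {ι M N : Type*} [AddCommGroup M] [AddCommGroup N] (P : RootDatum ι M N)
variable {R : Type*} [CommRing R] (F : FormalGroup R)

/-- `u` lies in `I_F^n` and its class in `I_F^n / I_F^{n+1}` is the image of `a`. -/
def HasSymbol (n : ℕ) (a : SymR R M) (u : FGR F M) : Prop :=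
  ∃ p : MvPolynomial M R, p.IsHomogeneous n ∧ aeval (symVar R) p = a ∧
    u - aeval (x F) p ∈ IF F M ^ (n + 1)

variable {F}

theorem HasSymbol.mem_IF_pow {n : ℕ} {a : SymR R M} {u : FGR F M} (h : HasSymbol F n a u) :
    u ∈ IF F M ^ n := by
  obtain ⟨p, hp, -, hu⟩ := h
  have := add_mem (Ideal.pow_le_pow_right n.le_succ hu)
    (aeval_x_mem_IF_pow F (IsHomogeneous.mem_augIdeal_pow hp))
  rwa [sub_add_cancel] at this

theorem HasSymbol.aug_eq_zero {n : ℕ} (hn : n ≠ 0) {a : SymR R M} {u : FGR F M}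
    (h : HasSymbol F n a u) : aug F M u = 0 :=
  (mem_IF F).1 (Ideal.pow_le_self hn h.mem_IF_pow)

theorem HasSymbol.aug_eq {r : R} {u : FGR F M} (h : HasSymbol F 0 (algebraMap R _ r) u) :
    aug F M u = r := by
  obtain ⟨p, hp, ha, hu⟩ := h
  rw [← totalDegree_zero_iff_isHomogeneous, totalDegree_eq_zero_iff_eq_C] at hp
  rw [hp, aeval_C] at ha hu
  rw [zero_add, pow_one, mem_IF, map_sub, aug_algebraMap, sub_eq_zero] at hu
  rw [hu]
  exact algebraMap_symR_injective ha

variable [F.IsComm] [Module.Free ℤ M] [Module.Finite ℤ M] (h2 : ∀ r : R, 2 * r = 0 → r = 0)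

include h2

theorem HasSymbol.del (i : ι) {n : ℕ} {a : SymR R M} {u : FGR F M} (h : HasSymbol F (n + 1) a u) :
    HasSymbol F n (symDel P R i a) (Del P F i u) := by
  obtain ⟨p, hp, rfl, hu⟩ := h
  obtain ⟨q, hq, -, hqs, hqx⟩ := exists_del_aeval_sub_mem P F h2 i hp
  refine ⟨q, hq, hqs, ?_⟩
  have := add_mem (del_mem_IF_pow P F h2 i hu) hqx
  rwa [← add_sub_assoc, ← del_add P F h2, sub_add_cancel] at this

/-- An operator `u ↦ u * e + c * Δ_α(u)` acts on symbols as `c * Δ_α`. -/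
theorem HasSymbol.mul_add_algebraMap_mul_del (i : ι) {n : ℕ} {a : SymR R M} {u : FGR F M}
    (h : HasSymbol F (n + 1) a u) (e : FGR F M) (c : R) :
    HasSymbol F n (algebraMap R _ c * symDel P R i a)
      (u * e + algebraMap R _ c * Del P F i u) := by
  obtain ⟨p, hp, hps, hu⟩ := h.del P h2 i
  refine ⟨C c * p, hp.C_mul c, by rw [map_mul, aeval_C, hps], ?_⟩
  rw [map_mul, aeval_C, add_sub_assoc, ← mul_sub]
  -- The term `u e` keeps order `n + 1`, so it does not contribute to the symbol in degree `n`.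
  exact add_mem (Ideal.mul_mem_right _ _ h.mem_IF_pow) (Ideal.mul_mem_left _ _ hu)

variable {P} (b : P.Base)

theorem HasSymbol.word {T : ι → FGR F M → FGR F M} {e : ι → FGR F M} {c : R}
    (hT : ∀ i u, T i u = u * e i + algebraMap R _ c * Del P F i u) (I : List b.support) {n : ℕ}
    {a : SymR R M} {u : FGR F M} (h : HasSymbol F (n + I.length) a u) :
    HasSymbol F n (algebraMap R _ (c ^ I.length) * symDelWord b R I a)
      (I.foldr (fun (i : b.support) v => T (i : ι) v) u) := by
  induction I generalizing n with
  | nil => simpa using h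
  | cons i I ih =>
    have h1 : HasSymbol F (n + 1 + I.length) a u := by
      rwa [List.length_cons, ← add_assoc, add_right_comm] at h
    have h3 := (ih h1).mul_add_algebraMap_mul_del P h2 (i : ι) (e i) c
    rw [List.foldr_cons, hT, symDelWord_cons, List.length_cons, pow_succ', map_mul, mul_assoc]
    rwa [symDel_mul P h2, symDel_algebraMap P h2, zero_mul, zero_add, AlgHom.commutes] at h3

end Symbol

/-! ### The basis theorem for words of operators -/

section WordBasis

variable {ι M N : Type*} [AddCommGroup M] [AddCommGroup N] (P : RootDatum ι M N)
variable {R : Type*} [CommRing R] (F : FormalGroup R)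

theorem weylAct_one (u : FGR F M) : weylAct P F 1 u = u :=
  hat_eq_self F (fun l => one_smul P.weylGroup l) u

theorem weylAct_mul (v w : P.weylGroup) (u : FGR F M) :
    weylAct P F (v * w) u = weylAct P F v (weylAct P F w u) := by
  rw [weylAct, weylAct, weylAct, hat_hat]
  congr 2

theorem refl_eq_weylAct (i : ι) : refl P F i = weylAct P F (weylGroup.ofIdx P i) := rfl

theorem refl_refl (i : ι) (u : FGR F M) : refl P F i (refl P F i u) = u := by
  rw [refl_eq_weylAct, ← weylAct_mul, ofIdx_mul_self, weylAct_one]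

theorem refl_mem_nonZeroDivisors (i : ι) {y : FGR F M} (hy : y ∈ nonZeroDivisors (FGR F M)) :
    refl P F i y ∈ nonZeroDivisors (FGR F M) := by
  rw [mem_nonZeroDivisors_iff_right] at hy ⊢
  intro u hu
  have h := congrArg (refl P F i) hu
  rw [map_mul, refl_refl, map_zero] at h
  rw [← refl_refl P F i u, hy _ h, map_zero]

variable {P} in
theorem delWord_eq_foldr (b : P.Base) (I : List b.support) (u : FGR F M) :
    DelWord b F I u = I.foldr (fun (i : b.support) v => Del P F (i : ι) v) u := by
  induction I with
  | nil => rfl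
  | cons i I ih => exact congrArg (Del P F (i : ι)) ih

variable {P} in
theorem cWord_eq_foldr (b : P.Base) (I : List b.support) (u : FGR F M) :
    CWord b F I u = I.foldr (fun (i : b.support) v => COp P F (i : ι) v) u := by
  induction I with
  | nil => rfl
  | cons i I ih => exact congrArg (COp P F (i : ι)) ih

variable [F.IsComm] [Module.Free ℤ M] [Module.Finite ℤ M] (h2 : ∀ r : R, 2 * r = 0 → r = 0)

include h2

variable {P} (b : P.Base)

/-- A composition of operators `u ↦ u * e + c * Δ_α(u)` is, up to a regular denominator, a linear
combination of the elements of the Weyl group. -/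
theorem exists_mul_word_eq_sum [Fintype P.weylGroup] {T : ι → FGR F M → FGR F M} {e : ι → FGR F M}
    {c : R} (hT : ∀ i u, T i u = u * e i + algebraMap R _ c * Del P F i u) (I : List b.support) :
    ∃ y ∈ nonZeroDivisors (FGR F M), ∃ a : P.weylGroup → FGR F M, ∀ u,
      y * I.foldr (fun (i : b.support) v => T (i : ι) v) u = ∑ w, a w * weylAct P F w u := by
  classical
  induction I with
  | nil =>
    refine ⟨1, one_mem _, fun w => if w = 1 then 1 else 0, fun u => ?_⟩
    simp [weylAct_one]
  | cons i I ih =>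
    obtain ⟨y, hy, a, ha⟩ := ih
    let z := x F (P.root i)
    let s := weylGroup.ofIdx P (i : ι)
    -- Multiply `z Δ_i(v) = v - s_i(v)` by `c y s_i(y)`: `y v` is known, and `s_i(y) s_i(v)` is its
    -- image under `s_i`, reindexed by `w ↦ s_i w`.
    refine ⟨z * (refl P F i y * y), mul_mem (x_root_mem_nonZeroDivisors P F h2 i)
      (mul_mem (refl_mem_nonZeroDivisors P F i hy) hy),
      fun w => (z * e i + algebraMap R _ c) * refl P F i y * a w -
        algebraMap R _ c * y * refl P F i (a (s * w)), fun u => ?_⟩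
    rw [List.foldr_cons]
    set v := I.foldr (fun (i : b.support) v => T (i : ι) v) u with hv
    have h1 : Del P F i v * z = v - refl P F i v :=
      divDiff_mul_self (exists_mul_x_root F P (i : ι)) v
    have h3 : refl P F i y * refl P F i v = ∑ w, refl P F i (a (s * w)) * weylAct P F w u := by
      rw [← map_mul, ha, map_sum, ← Equiv.sum_comp (Equiv.mulLeft s)]
      refine Finset.sum_congr rfl fun w _ => ?_
      rw [map_mul, Equiv.coe_mulLeft, refl_eq_weylAct, ← weylAct_mul, ofIdx_mul_cancel]
    simp only [sub_mul, Finset.sum_sub_distrib, mul_assoc, ← Finset.mul_sum]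
    rw [← ha, ← h3, hT]
    linear_combination (refl P F (i : ι) y * y * algebraMap R _ c) * h1

set_option synthInstance.maxHeartbeats 200000 in
/-- The main criterion: the words in operators `u ↦ u * e + c * Δ_α(u)`, applied to `u₀`, form a
basis over the invariants. -/
theorem exists_basis_word [Finite ι] [P.IsReduced] {T : ι → FGR F M → FGR F M} {e : ι → FGR F M} {c : R} (hc : IsUnit c)
    (hT : ∀ i u, T i u = u * e i + algebraMap R _ c * Del P F i u)
    (hτ : IsUnit (torsionIndex b : R)) (I : P.weylGroup → List b.support)
    (hI : ∀ w, IsReducedDecomp b w (I w)) {u₀ : FGR F M} (hu₀ : IsTorsionLift b F u₀) :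
    ∃ B : Module.Basis P.weylGroup (invariants P F) (FGR F M),
      ∀ w, B w = (I w).foldr (fun (i : b.support) v => T (i : ι) v) u₀ := by
  classical
  obtain ⟨w₀, I₀, a, hw₀, hI₀, ha, -, -, hsymb⟩ := hu₀
  have hu : HasSymbol F I₀.length a u₀ := hsymb
  have hgen : ∀ w, ∃ J, wordProd b J = w := fun w => ⟨I w, (hI w).1⟩
  have := finite_weylGroup b hgen hw₀
  have := Fintype.ofFinite P.weylGroup
  refine exists_basis_of_isUnit_det (weylAct P F) (weylAct_one P F) (weylAct_mul P F)
    (invariants P F) (fun u => Iff.rfl) (fun w => (I w).foldr fun (i : b.support) v => T (i : ι) v)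
    (fun w => exists_mul_word_eq_sum F h2 b hT (I w)) _ ?_
  -- From here on only the augmentations of the entries matter.
  refine isUnit_of_isUnit_aug F ?_
  rw [RingHom.map_det]
  choose σ hσ hσl using hw₀.exists_mul_eq hgen
  have hσ' : ∀ w, σ w = w₀ * w⁻¹ := fun w => eq_mul_inv_of_mul_eq (hσ w)
  let σe : P.weylGroup ≃ P.weylGroup := (Equiv.inv _).trans (Equiv.mulLeft w₀)
  have hσe : ∀ w, σe w = σ w := fun w => (hσ' w).symm
  have hlen : ∀ v w, (I v ++ I w).length = length b v + length b w := fun v w => by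
    rw [List.length_append, (hI v).2, (hI w).2]
  have hentry : ∀ v w, (aug F M).mapMatrix (Matrix.of fun v w =>
      (I v).foldr (fun (i : b.support) v => T (i : ι) v)
        ((I w).foldr (fun (i : b.support) v => T (i : ι) v) u₀)) v w =
      aug F M ((I v ++ I w).foldr (fun (i : b.support) v => T (i : ι) v) u₀) := fun v w => by
    rw [List.foldr_append]; rfl
  have haug : ∀ (J : List b.support) (r : R), J.length = I₀.length →
      symDelWord b R J a = algebraMap R _ r →
      aug F M (J.foldr (fun (i : b.support) v => T (i : ι) v) u₀) = c ^ J.length * r := by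
    intro J r hJ hr
    have h := HasSymbol.word h2 b hT J (n := 0) (a := a) (u := u₀) (by rwa [zero_add, hJ])
    rw [hr, ← map_mul] at h
    exact h.aug_eq
  -- The row matched with the column `w` is `w₀ w⁻¹`, of length `N - ℓ(w)`; entries with total
  -- length above `N` lie on the unconstrained side of the diagonal.
  refine isUnit_det_of_triangular (length b) _ σe (fun w => ?_) fun v w hvw hl => ?_
  · have hJ : (I (σ w) ++ I w).length = I₀.length := by rw [hlen, hσl, hI₀.2]
    rw [hentry, hσe, haug _ (torsionIndex b : R) hJ]
    · exact (hc.pow _).mul hτ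
    · rw [← ha]
      refine (symDelWord_eq_and_eq_zero h2 b _).1 _ _ hJ rfl ?_ a
      rw [wordProd_append, (hI _).1, (hI _).1, hσ, hI₀.1]
  · rw [hentry, hσe]
    have hle : (I (σ v) ++ I w).length ≤ I₀.length := by
      rw [hlen, hI₀.2, ← hσl v]; omega
    rcases hle.eq_or_lt with hJ | hJ
    · rw [haug _ 0 hJ, mul_zero]
      rw [map_zero]
      -- A reduced word of length `N` has product `w₀`, the only longest element, which would force
      -- `v = w`.
      refine (symDelWord_eq_and_eq_zero h2 b _).2 _ hJ (fun hred => hvw ?_) a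
      have h3 : wordProd b (I (σ v) ++ I w) = w₀ := by
        refine IsLongest.eq hgen (fun w => ?_) hw₀
        rw [← hred, hJ, hI₀.2]
        exact hw₀ w
      rw [wordProd_append, (hI _).1, (hI _).1, ← hσ v] at h3
      exact (mul_left_cancel h3).symm
    -- The word is too short to bring `u₀` down to degree zero.
    · obtain ⟨k, hk⟩ := Nat.exists_eq_add_of_lt hJ
      have h := HasSymbol.word h2 b hT (I (σ v) ++ I w) (n := k + 1) (a := a) (u := u₀)
        (by rwa [show k + 1 + (I (σ v) ++ I w).length = I₀.length by omega])
      exact h.aug_eq_zero (Nat.succ_ne_zero k)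

end WordBasis

end FormalGroupRing

end

/-! ### The two families `Δ` and `C` -/

theorem mainTheorem3 {R : Type*} [CommRing R] (F : FormalGroup R) [F.IsComm]
    {ι M N : Type*} [Finite ι] [AddCommGroup M] [AddCommGroup N]
    [Module.Free ℤ M] [Module.Finite ℤ M]
    (P : RootDatum ι M N) [P.IsReduced] (b : P.Base)
    (hτ : IsUnit (FormalGroupRing.torsionIndex b : R))
    (h2 : ∀ r : R, 2 * r = 0 → r = 0)
    (I : P.weylGroup → List b.support)
    (hI : ∀ w, FormalGroupRing.IsReducedDecomp b w (I w))
    (u₀ : FormalGroupRing.FGR F M) (hu₀ : FormalGroupRing.IsTorsionLift b F u₀) :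
    (∃ B : Module.Basis P.weylGroup (FormalGroupRing.invariants P F) (FormalGroupRing.FGR F M),
      ∀ w, B w = FormalGroupRing.DelWord b F (I w) u₀) ∧
    (∃ B : Module.Basis P.weylGroup (FormalGroupRing.invariants P F) (FormalGroupRing.FGR F M),
      ∀ w, B w = FormalGroupRing.CWord b F (I w) u₀) := by
  constructor
  · obtain ⟨B, hB⟩ := FormalGroupRing.exists_basis_word F h2 b (T := FormalGroupRing.Del P F)
      (e := 0) (c := 1) isUnit_one (fun i u => by simp) hτ I hI hu₀
    exact ⟨B, fun w => by rw [hB, FormalGroupRing.delWord_eq_foldr]⟩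
  · obtain ⟨B, hB⟩ := FormalGroupRing.exists_basis_word F h2 b (T := FormalGroupRing.COp P F)
      (e := FormalGroupRing.eElt P F) (c := -1) isUnit_one.neg (fun i u => by
        rw [FormalGroupRing.COp, map_neg, map_one, neg_one_mul, sub_eq_add_neg]) hτ I hI hu₀
    exact ⟨B, fun w => by rw [hB, FormalGroupRing.cWord_eq_foldr]⟩
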